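/- Let $X$ be a real random variable of arbitrary distribution with power $\mathbb{E}[X^2]=P\in(0,\infty)$, let $Z>0$, and for $N\ge 0$ let $Y_N = X+Z'+N'$, where $Z'\sim\mathcal{N}(0,Z)$ (physical noise) and $N'\sim\mathcal{N}(0,N)$ (artificial noise of power $N$) are such that $X,Z',N'$ are independent. Let $I(X;Y_N)=D_{\mathrm{KL}}(P_{XY_N}\,\|\,P_X\otimes P_{Y_N})$. Let $S=X/\sqrt{P}$, let $W\sim\mathcal{N}(0,1)$ be independent of $S$, and for $\rho>0$ put $\widetilde Y_\rho=\sqrt{\rho}\,S+W$, let $f_\rho(y)=\mathbb{E}[\varphi(y-\sqrt\rho S)]$ be its probability density function ($\varphi$ the standard normal density), and define $$\mathsf{mmse}(\rho)=\mathbb{E}\big[(S-\mathbb{E}[S\mid\widetilde Y_\rho])^2\big],\qquad \mathcal{J}(\widetilde Y_\rho)=\mathbb{E}\big[\big((\log f_\rho)'(\widetilde Y_\rho)\big)^2\big].$$ For $\rho>0$ consider the conditions - (C1) $\mathsf{mmse}(\rho)+\frac{d}{d\rho}\big(\rho\,\mathsf{mmse}(\rho)\big)\ge 0$; - (C2) $\frac{d}{d\rho}\big(\rho\,\mathcal{J}(\widetilde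 Y_\rho)\big)\le 1$; - (C3) $\mathbb{E}\big[\big((\log f_\rho)''(\widetilde Y_\rho)\big)^2\big]\le 1$. Then $I(X;Y_N)<\infty$ for all $N\ge0$; for every $\rho>0$ the density $f_\rho$ is positive and twice continuously differentiable, the expectations in $\mathcal J(\widetilde Y_\rho)$ and in (C3) are finite, and $\rho\,\mathsf{mmse}(\rho)$ and $\rho\,\mathcal{J}(\widetilde Y_\rho)$ are differentiable in $\rho$. For every $\rho>0$ the conditions (C1), (C2) and (C3) are equivalent. Moreover, for every interval $D\subseteq[0,\infty)$ with more than one point (in particular for $D=[0,\infty)$) and each $k\in\{1,2,3\}$, the function $N\mapsto I(X;Y_N)$ is convex on $D$ if and only if condition (C$k$) holds at $\rho=\frac{P}{N+Z}$ for every $N\in D$. -/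

import Mathlib

open MeasureTheory ProbabilityTheory Set
open scoped ENNReal NNReal

namespace NoiseConvexity

/-- The mutual information `I(X;Y) = D_KL(P_{XY} ‖ P_X ⊗ P_Y)` (in nats) of two real random
variables. -/
noncomputable def mutualInfo {Ω : Type*} [MeasurableSpace Ω] (μ : Measure Ω) (X Y : Ω → ℝ) : ℝ≥0∞ :=
  InformationTheory.klDiv (μ.map (fun ω => (X ω, Y ω))) ((μ.map X).prod (μ.map Y))

/-- The output `√ρ S + W` of the normalized channel with signal-to-noise ratio `ρ`. -/
noncomputable def channelOutput {Ω : Type*} (S W : Ω → ℝ) (ρ : ℝ) : Ω → ℝ :=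
  fun ω => √ρ * S ω + W ω

/-- `mmse(ρ) = E[(S - E[S | √ρ S + W])²]`. -/
noncomputable def mmse {Ω : Type*} [MeasurableSpace Ω] (μ : Measure Ω) (S W : Ω → ℝ) (ρ : ℝ) : ℝ :=
  ∫ ω, (S ω - (μ[S | MeasurableSpace.comap (channelOutput S W ρ) inferInstance]) ω) ^ 2 ∂μ

/-- The (everywhere defined) probability density function `y ↦ E[φ(y - √ρ S)]` of `√ρ S + W`, where
`W` is standard normal, independent of `S`, and `φ` is the standard normal density; see
`map_channelOutput`. -/
noncomputable def outputDensity {Ω : Type*} [MeasurableSpace Ω] (μ : Measure Ω) (S : Ω → ℝ) (ρ : ℝ) :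
    ℝ → ℝ :=
  fun y => ∫ ω, gaussianPDFReal 0 1 (y - √ρ * S ω) ∂μ

/-- The score `(log f)'`, where `f` is the density of the channel output. -/
noncomputable def score {Ω : Type*} [MeasurableSpace Ω] (μ : Measure Ω) (S : Ω → ℝ) (ρ : ℝ) : ℝ → ℝ :=
  deriv (fun y => Real.log (outputDensity μ S ρ y))

/-- The second derivative `(log f)''`, where `f` is the density of the channel output. -/
noncomputable def logDensityDeriv2 {Ω : Type*} [MeasurableSpace Ω] (μ : Measure Ω) (S : Ω → ℝ)
    (ρ : ℝ) : ℝ → ℝ :=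
  iteratedDeriv 2 (fun y => Real.log (outputDensity μ S ρ y))

/-- The Fisher information `J = E[((log f)'(√ρ S + W))²]` of the channel output. -/
noncomputable def fisherInfo {Ω : Type*} [MeasurableSpace Ω] (μ : Measure Ω) (S W : Ω → ℝ) (ρ : ℝ) :
    ℝ :=
  ∫ ω, (score μ S ρ (channelOutput S W ρ ω)) ^ 2 ∂μ

/-- `mmse(ρ) + d/dρ (ρ · mmse(ρ)) ≥ 0`. -/
def C1 {Ω : Type*} [MeasurableSpace Ω] (μ : Measure Ω) (S W : Ω → ℝ) (ρ : ℝ) : Prop :=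
  0 ≤ mmse μ S W ρ + deriv (fun r => r * mmse μ S W r) ρ

/-- `d/dρ (ρ · J) ≤ 1`. -/
def C2 {Ω : Type*} [MeasurableSpace Ω] (μ : Measure Ω) (S W : Ω → ℝ) (ρ : ℝ) : Prop :=
  deriv (fun r => r * fisherInfo μ S W r) ρ ≤ 1

/-- `E[((log f)''(√ρ S + W))²] ≤ 1`. -/
def C3 {Ω : Type*} [MeasurableSpace Ω] (μ : Measure Ω) (S W : Ω → ℝ) (ρ : ℝ) : Prop :=
  ∫ ω, (logDensityDeriv2 μ S ρ (channelOutput S W ρ ω)) ^ 2 ∂μ ≤ 1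

/-- `outputDensity` is a density of the channel output. -/
theorem map_channelOutput {Ω : Type*} [MeasurableSpace Ω] (μ : Measure Ω) [IsProbabilityMeasure μ]
    (S W : Ω → ℝ) (hS : Measurable S) (hW : Measurable W) (hWlaw : HasLaw W (gaussianReal 0 1) μ)
    (hSW : IndepFun S W μ) (ρ : ℝ) :
    μ.map (channelOutput S W ρ)
      = volume.withDensity (fun y => ENNReal.ofReal (outputDensity μ S ρ y)) := by
  have hmeas : Measurable fun p : ℝ × Ω => gaussianPDFReal 0 1 (p.1 - √ρ * S p.2) :=
    (measurable_gaussianPDFReal 0 1).comp (by fun_prop)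
  have hdens : ∀ y, ENNReal.ofReal (outputDensity μ S ρ y)
      = ∫⁻ ω, gaussianPDF 0 1 (y - √ρ * S ω) ∂μ := by
    intro y
    have hle : ∀ x, gaussianPDFReal 0 1 x ≤ (√(2 * Real.pi * (1 : ℝ≥0)))⁻¹ := by
      intro x
      rw [gaussianPDFReal]
      refine mul_le_of_le_one_right (by positivity) (Real.exp_le_one_iff.2 ?_)
      exact div_nonpos_of_nonpos_of_nonneg (by nlinarith [sq_nonneg (x - 0)]) (by positivity)
    refine ofReal_integral_eq_lintegral_ofReal ?_ ?_
    · refine Integrable.of_bound (C := (√(2 * Real.pi * (1 : ℝ≥0)))⁻¹)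
        (hmeas.comp measurable_prodMk_left).aestronglyMeasurable (.of_forall fun ω => ?_)
      rw [Real.norm_of_nonneg (gaussianPDFReal_nonneg _ _ _)]
      exact hle _
    · exact .of_forall fun ω => gaussianPDFReal_nonneg _ _ _
  have hmeas' : Measurable fun p : ℝ × Ω => gaussianPDF 0 1 (p.1 - √ρ * S p.2) :=
    ENNReal.measurable_ofReal.comp hmeas
  ext A hA
  have hjoint : μ.map (fun ω => (S ω, W ω)) = (μ.map S).prod (gaussianReal 0 1) := by
    rw [← hWlaw.map_eq]
    exact (indepFun_iff_map_prod_eq_prod_map_map hS.aemeasurable hW.aemeasurable).1 hSW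
  have hcomp : channelOutput S W ρ
      = (fun p : ℝ × ℝ => √ρ * p.1 + p.2) ∘ (fun ω => (S ω, W ω)) := rfl
  have hg : Measurable fun p : ℝ × ℝ => √ρ * p.1 + p.2 := by fun_prop
  rw [hcomp, ← Measure.map_map hg (hS.prodMk hW), hjoint, Measure.map_apply hg hA,
    Measure.prod_apply (hg hA), lintegral_map (measurable_measure_prodMk_left (hg hA)) hS,
    withDensity_apply _ hA]
  simp_rw [hdens]
  rw [lintegral_lintegral_swap (by exact hmeas'.aemeasurable)]
  refine lintegral_congr fun ω => ?_
  rw [gaussianReal_of_var_ne_zero 0 one_ne_zero,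
    withDensity_apply _ (measurable_prodMk_left (hg hA)), ← lintegral_indicator hA,
    ← lintegral_indicator (measurable_prodMk_left (hg hA)),
    ← lintegral_add_left_eq_self (A.indicator fun y => gaussianPDF 0 1 (y - √ρ * S ω)) (√ρ * S ω)]
  refine lintegral_congr fun w => ?_
  by_cases h : √ρ * S ω + w ∈ A <;> simp [Set.indicator, Set.mem_preimage, h]

end NoiseConvexity

/-! Write `ν` for the law of `X`, `t = N + Z` for the total noise power, `G` for the total noise and
`Y = X + G`. Let `m_k(t, y)` be `gaussMoment ν k t y`, so that `m_0` is the density of `Y` and `m_k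
/ m_0` is the conditional mean of `G ^ k` given `Y = y`. Two functions of `t` carry the proof: the
noise energy `L(t) = E[E[G | Y]²]` and the variance defect `V(t) = E[(Var(G | Y) / t - 1)²]`.

The mutual information is `-log(2πt)/2 - 1/2 - H(t)` with `H = ∫ m_0 log m_0`. De Bruijn's identity,
`hasDerivAt_negEntropy`, gives `H' = -L / (2t²)`. A second differentiation,
`hasDerivAt_noiseEnergy`, gives `L' = 2L/t - V`. The terms in `L` cancel, and the second derivative
of the information in `N` is `(1 - V) / (2t²)`. Convexity therefore means `V ≤ 1` at every point of
the interval.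

Multiplying the normalized output by `√(P/ρ)` gives an output of the original form with `t = P/ρ`.
Hence `J = L/t` and `mmse = (t - L)/P`. The formula for `L'` then yields `(ρ J)' = V` and `mmse + (ρ
mmse)' = (1 - V)/ρ`, while `(log f)''` at the output is `Var(G | Y)/t - 1`, whose second moment is
`V`. So each of the three conditions says `V(P/ρ) ≤ 1`.

Both differentiations pass under the integral, use that the `m_k` are closed under derivatives in
`y` and `t`, and finish by subtracting an exact `y`-derivative, whose integral over the line is
zero. -/

namespace NoiseConvexity

/-! ### Gaussian kernel, its moments against a measure, and their derivatives -/

section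

/-- The centred Gaussian density of variance `t`. -/
noncomputable def heatKernel (t z : ℝ) : ℝ :=
  (√(2 * Real.pi * t))⁻¹ * Real.exp (-z ^ 2 / (2 * t))

/-- The convolution of `ν` with `z ↦ z ^ k * heatKernel t z`. -/
noncomputable def gaussMoment (ν : Measure ℝ) (k : ℕ) (t y : ℝ) : ℝ :=
  ∫ x, (y - x) ^ k * heatKernel t (y - x) ∂ν

lemma gaussianPDFReal_eq_heatKernel (v : ℝ≥0) (x z : ℝ) :
    gaussianPDFReal x v z = heatKernel v (z - x) := rfl

lemma heatKernel_pos {t : ℝ} (ht : 0 < t) (z : ℝ) : 0 < heatKernel t z := by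
  unfold heatKernel; positivity

lemma heatKernel_nonneg (t z : ℝ) : 0 ≤ heatKernel t z := by
  unfold heatKernel; positivity

@[fun_prop]
lemma continuous_heatKernel (t : ℝ) : Continuous (heatKernel t) := by
  unfold heatKernel; fun_prop

@[fun_prop]
lemma measurable_heatKernel (t : ℝ) : Measurable (heatKernel t) :=
  (continuous_heatKernel t).measurable

lemma log_heatKernel {t : ℝ} (ht : 0 < t) (z : ℝ) :
    Real.log (heatKernel t z) = -(Real.log (2 * Real.pi * t) / 2) - z ^ 2 / (2 * t) := by
  unfold heatKernel
  rw [Real.log_mul (by positivity) (Real.exp_pos _).ne', Real.log_inv, Real.log_exp,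
    Real.log_sqrt (by positivity)]
  ring

lemma heatKernel_le_const {t : ℝ} (z : ℝ) (ht : 0 ≤ t) :
    heatKernel t z ≤ (√(2 * Real.pi * t))⁻¹ := by
  refine mul_le_of_le_one_right (by positivity) (Real.exp_le_one_iff.2 ?_)
  exact div_nonpos_of_nonpos_of_nonneg (by nlinarith [sq_nonneg z]) (by positivity)

/-- The exponential factor increases with `t` and the normalization decreases, so each is taken at
the worse endpoint. This provides dominating functions that are uniform over a window of times. -/
lemma heatKernel_le {a b t : ℝ} (ha : 0 < a) (hat : a ≤ t) (htb : t ≤ b) (z : ℝ) :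
    heatKernel t z ≤ √(b / a) * heatKernel b z := by
  have ht : 0 < t := ha.trans_le hat
  have hb : 0 < b := ht.trans_le htb
  unfold heatKernel
  have h1 : √(b / a) * (√(2 * Real.pi * b))⁻¹ = (√(2 * Real.pi * a))⁻¹ := by
    rw [← Real.sqrt_inv, ← Real.sqrt_inv, ← Real.sqrt_mul (by positivity)]
    congr 1
    field_simp
  rw [← mul_assoc, h1]
  have h2 : -z ^ 2 / (2 * t) ≤ -z ^ 2 / (2 * b) := by
    rw [neg_div, neg_div, neg_le_neg_iff]
    gcongr
  gcongr

/-- This is `x ^ k / k! ≤ exp x` at `x = z² / (2b)`. -/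
lemma even_pow_mul_heatKernel_le {b : ℝ} (hb : 0 < b) (k : ℕ) (z : ℝ) :
    z ^ (2 * k) * heatKernel b z ≤ (√(2 * Real.pi * b))⁻¹ * (k.factorial * (2 * b) ^ k) := by
  have h := Real.pow_div_factorial_le_exp (x := z ^ 2 / (2 * b)) (by positivity) k
  have hE : Real.exp (-z ^ 2 / (2 * b)) * Real.exp (z ^ 2 / (2 * b)) = 1 := by
    rw [← Real.exp_add]; simp [neg_div]
  have h2 : z ^ (2 * k) * Real.exp (-z ^ 2 / (2 * b)) ≤ k.factorial * (2 * b) ^ k := by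
    have h3 : z ^ (2 * k) ≤ k.factorial * (2 * b) ^ k * Real.exp (z ^ 2 / (2 * b)) := by
      rw [div_pow, div_div, div_le_iff₀ (by positivity)] at h
      rw [pow_mul]; linarith
    calc _ ≤ _ := mul_le_mul_of_nonneg_right h3 (Real.exp_pos (-z ^ 2 / (2 * b))).le
      _ = k.factorial * (2 * b) ^ k
          * (Real.exp (-z ^ 2 / (2 * b)) * Real.exp (z ^ 2 / (2 * b))) := by ring
      _ = _ := by rw [hE, mul_one]
  unfold heatKernel
  calc _ = (√(2 * Real.pi * b))⁻¹ * (z ^ (2 * k) * Real.exp (-z ^ 2 / (2 * b))) := by ring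
    _ ≤ _ := by gcongr

lemma exists_abs_pow_mul_heatKernel_le {a b : ℝ} (ha : 0 < a) (k : ℕ) :
    ∃ C, ∀ t, a ≤ t → t ≤ b → ∀ z, |z ^ k * heatKernel t z| ≤ C := by
  refine ⟨√(b / a) * ((√(2 * Real.pi * b))⁻¹ * ((0).factorial * (2 * b) ^ 0)
    + (√(2 * Real.pi * b))⁻¹ * (k.factorial * (2 * b) ^ k)), fun t hat htb z => ?_⟩
  have hb : 0 < b := ha.trans_le (hat.trans htb)
  have h0 := even_pow_mul_heatKernel_le hb 0 z
  have hk := even_pow_mul_heatKernel_le hb k z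
  -- Odd powers reduce to even ones through `|u| ≤ 1 + u²`.
  have hz : |z ^ k| ≤ z ^ (2 * 0) + z ^ (2 * k) := by
    have : z ^ (2 * k) = |z ^ k| ^ 2 := by rw [sq_abs, ← pow_mul, mul_comm]
    rw [this]; simp only [mul_zero, pow_zero]
    nlinarith [sq_nonneg (|z ^ k| - 1), abs_nonneg (z ^ k)]
  rw [abs_mul, abs_of_nonneg (heatKernel_nonneg t z)]
  calc _ ≤ (z ^ (2 * 0) + z ^ (2 * k)) * (√(b / a) * heatKernel b z) := by
        gcongr
        · exact heatKernel_nonneg t z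
        · exact (abs_nonneg _).trans hz
        · exact heatKernel_le ha hat htb z
    _ = √(b / a) * (z ^ (2 * 0) * heatKernel b z + z ^ (2 * k) * heatKernel b z) := by ring
    _ ≤ _ := by gcongr

lemma hasDerivAt_heatKernel_space (t z : ℝ) :
    HasDerivAt (heatKernel t) (-(z / t) * heatKernel t z) z := by
  unfold heatKernel
  have h : HasDerivAt (fun z : ℝ => -z ^ 2 / (2 * t)) (-(z / t)) z := by
    refine (((hasDerivAt_pow 2 z).neg).div_const (2 * t)).congr_deriv ?_
    -- At `t = 0` both sides vanish because division by zero gives zero.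
    by_cases ht : t = 0
    · simp [ht]
    · field_simp; simp
  refine (h.exp.const_mul _).congr_deriv ?_
  ring

lemma hasDerivAt_heatKernel_time {t : ℝ} (ht : 0 < t) (z : ℝ) :
    HasDerivAt (fun t => heatKernel t z)
      ((z ^ 2 / (2 * t ^ 2) - 1 / (2 * t)) * heatKernel t z) t := by
  unfold heatKernel
  have hpt : 0 < 2 * Real.pi * t := by positivity
  have h1 : HasDerivAt (fun t : ℝ => (√(2 * Real.pi * t))⁻¹)
      (-(1 / (2 * t)) * (√(2 * Real.pi * t))⁻¹) t := by
    have h := (((hasDerivAt_id t).const_mul (2 * Real.pi)).sqrt hpt.ne').inv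
      (Real.sqrt_ne_zero'.2 hpt)
    refine h.congr_deriv ?_
    have hs : √(2 * Real.pi * t) ≠ 0 := Real.sqrt_ne_zero'.2 hpt
    simp only [id, mul_one]
    rw [Real.sq_sqrt hpt.le]
    field_simp
  have h2 : HasDerivAt (fun t : ℝ => -z ^ 2 / (2 * t)) (z ^ 2 / (2 * t ^ 2)) t := by
    have h := ((hasDerivAt_id t).const_mul (2 : ℝ)).inv (by simpa using ht.ne')
    refine (h.const_mul (-z ^ 2)).congr_deriv ?_
    simp only [id]
    field_simp
  refine (h1.mul h2.exp).congr_deriv ?_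
  ring

lemma integrable_pow_mul_heatKernel {t : ℝ} (ht : 0 < t) (k : ℕ) :
    Integrable (fun z => z ^ k * heatKernel t z) := by
  have h := integrable_rpow_mul_exp_neg_mul_sq (b := 1 / (2 * t)) (by positivity) (s := k)
    (by have : (0 : ℝ) ≤ k := k.cast_nonneg
        linarith)
  refine (h.const_mul (√(2 * Real.pi * t))⁻¹).congr (.of_forall fun z => ?_)
  simp only [heatKernel, Real.rpow_natCast]
  rw [show -(1 / (2 * t)) * z ^ 2 = -z ^ 2 / (2 * t) by ring]
  ring

/-- The shear `(x, y) ↦ (x, y - x)` preserves `ν.prod volume` and separates the variables. Only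
moments of the noise appear, so `ν` needs no moments beyond the integrability of `w`. -/
lemma integrable_prod_pow_mul_heatKernel (ν : Measure ℝ) [SFinite ν] {t : ℝ} (ht : 0 < t) (k : ℕ)
    {w : ℝ → ℝ} (hw : Integrable w ν) :
    Integrable (fun p : ℝ × ℝ => w p.1 * ((p.2 - p.1) ^ k * heatKernel t (p.2 - p.1)))
      (ν.prod volume) := by
  have h := (measurePreserving_prod_neg_add ν (volume : Measure ℝ)).integrable_comp_of_integrable
    (hw.mul_prod (integrable_pow_mul_heatKernel ht k))
  refine h.congr (.of_forall fun p => ?_)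
  simp only [Function.comp]
  rw [neg_add_eq_sub]

variable (ν : Measure ℝ)

lemma integrable_gaussMoment [IsFiniteMeasure ν] {t : ℝ} (ht : 0 < t) (k : ℕ) :
    Integrable (gaussMoment ν k t) := by
  have h := integrable_prod_pow_mul_heatKernel ν ht k (integrable_const (1 : ℝ))
  refine h.integral_prod_right.congr (.of_forall fun y => ?_)
  simp [gaussMoment]

lemma integrable_gaussMoment_integrand [IsFiniteMeasure ν] {t : ℝ} (ht : 0 < t) (k : ℕ) (y : ℝ) :
    Integrable (fun x => (y - x) ^ k * heatKernel t (y - x)) ν := by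
  obtain ⟨C, hC⟩ := exists_abs_pow_mul_heatKernel_le (b := t) ht k
  refine Integrable.of_bound (C := C) (by fun_prop) (.of_forall fun x => ?_)
  exact hC t le_rfl le_rfl _

/-- Together with the time derivative below, this closes the family of moments under
differentiation. For `k = 0` the truncated index `k - 1` is harmless, its coefficient being zero. -/
lemma hasDerivAt_gaussMoment_space [IsFiniteMeasure ν] {t : ℝ} (ht : 0 < t) (k : ℕ) (y : ℝ) :
    HasDerivAt (gaussMoment ν k t)
      (k * gaussMoment ν (k - 1) t y - gaussMoment ν (k + 1) t y / t) y := by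
  obtain ⟨C, hC⟩ := exists_abs_pow_mul_heatKernel_le (b := t) ht (k - 1)
  obtain ⟨C', hC'⟩ := exists_abs_pow_mul_heatKernel_le (b := t) ht (k + 1)
  have key := hasDerivAt_integral_of_dominated_loc_of_deriv_le (μ := ν) (𝕜 := ℝ) (s := univ)
    (x₀ := y) (F := fun y x => (y - x) ^ k * heatKernel t (y - x))
    (F' := fun y x => k * ((y - x) ^ (k - 1) * heatKernel t (y - x))
      - ((y - x) ^ (k + 1) * heatKernel t (y - x)) / t)
    (bound := fun _ => k * C + C' / t) Filter.univ_mem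
    (.of_forall fun y => by fun_prop) (integrable_gaussMoment_integrand ν ht k y)
    (by fun_prop) (.of_forall fun x y _ => ?_) (integrable_const _)
    (.of_forall fun x y _ => ?_)
  · refine key.2.congr_deriv ?_
    rw [integral_sub, integral_const_mul, integral_div]
    · rfl
    · exact (integrable_gaussMoment_integrand ν ht _ y).const_mul _
    · exact (integrable_gaussMoment_integrand ν ht _ y).div_const _
  · refine (norm_sub_le _ _).trans (add_le_add ?_ ?_)
    · rw [norm_mul, Real.norm_natCast]
      exact mul_le_mul_of_nonneg_left (hC t le_rfl le_rfl _) (by positivity)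
    · rw [norm_div, Real.norm_of_nonneg ht.le]
      exact div_le_div_of_nonneg_right (hC' t le_rfl le_rfl _) ht.le
  · have h1 : HasDerivAt (fun y : ℝ => y - x) 1 y := (hasDerivAt_id y).sub_const x
    have h2 := (h1.pow k).mul ((hasDerivAt_heatKernel_space t (y - x)).comp y h1)
    refine h2.congr_deriv ?_
    simp only [Function.comp, Pi.pow_apply]
    ring

lemma continuous_gaussMoment [IsFiniteMeasure ν] {t : ℝ} (ht : 0 < t) (k : ℕ) :
    Continuous (gaussMoment ν k t) :=
  continuous_iff_continuousAt.2 fun y => (hasDerivAt_gaussMoment_space ν ht k y).continuousAt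

/-- For `k = 0`, comparison with the second spatial derivative gives the heat equation `∂_t m_0 =
∂_y² m_0 / 2`. -/
lemma hasDerivAt_gaussMoment_time [IsFiniteMeasure ν] {t : ℝ} (ht : 0 < t) (k : ℕ) (y : ℝ) :
    HasDerivAt (fun t => gaussMoment ν k t y)
      (gaussMoment ν (k + 2) t y / (2 * t ^ 2) - gaussMoment ν k t y / (2 * t)) t := by
  have ht2 : 0 < t / 2 := by positivity
  obtain ⟨C, hC⟩ := exists_abs_pow_mul_heatKernel_le (b := 2 * t) ht2 k
  obtain ⟨C', hC'⟩ := exists_abs_pow_mul_heatKernel_le (b := 2 * t) ht2 (k + 2)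
  have key := hasDerivAt_integral_of_dominated_loc_of_deriv_le (μ := ν) (𝕜 := ℝ)
    (s := Icc (t / 2) (2 * t))
    (x₀ := t) (F := fun t x => (y - x) ^ k * heatKernel t (y - x))
    (F' := fun t x => ((y - x) ^ (k + 2) * heatKernel t (y - x)) / (2 * t ^ 2)
      - ((y - x) ^ k * heatKernel t (y - x)) / (2 * t))
    (bound := fun _ => C' / (2 * (t / 2) ^ 2) + C / (2 * (t / 2)))
    (Icc_mem_nhds (by linarith) (by linarith))
    (.of_forall fun y => by fun_prop) (integrable_gaussMoment_integrand ν ht k y)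
    (by fun_prop) (.of_forall fun x s hs => ?_) (integrable_const _)
    (.of_forall fun x s hs => ?_)
  · refine key.2.congr_deriv ?_
    rw [integral_sub, integral_div, integral_div]
    · rfl
    · exact (integrable_gaussMoment_integrand ν ht _ y).div_const _
    · exact (integrable_gaussMoment_integrand ν ht _ y).div_const _
  · have hs0 : 0 < s := ht2.trans_le hs.1
    refine (norm_sub_le _ _).trans (add_le_add ?_ ?_)
    · rw [norm_div, Real.norm_of_nonneg (by positivity : 0 ≤ 2 * s ^ 2)]
      have h := hC' s hs.1 hs.2 (y - x)
      have h0 := (abs_nonneg _).trans h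
      exact div_le_div₀ h0 h (by positivity) (by gcongr; exact hs.1)
    · rw [norm_div, Real.norm_of_nonneg (by positivity : 0 ≤ 2 * s)]
      have h := hC s hs.1 hs.2 (y - x)
      have h0 := (abs_nonneg _).trans h
      exact div_le_div₀ h0 h (by positivity) (by gcongr; exact hs.1)
  · have hs0 : 0 < s := ht2.trans_le hs.1
    refine ((hasDerivAt_heatKernel_time hs0 (y - x)).const_mul ((y - x) ^ k)).congr_deriv ?_
    ring

lemma gaussMoment_even_nonneg (k : ℕ) (t y : ℝ) : 0 ≤ gaussMoment ν (2 * k) t y := by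
  refine integral_nonneg fun x => ?_
  have := heatKernel_nonneg t (y - x)
  have : 0 ≤ (y - x) ^ (2 * k) := by rw [pow_mul]; positivity
  positivity

lemma gaussMoment_even_le [IsFiniteMeasure ν] {a b t : ℝ} (ha : 0 < a) (hat : a ≤ t) (htb : t ≤ b)
    (k : ℕ) (y : ℝ) :
    gaussMoment ν (2 * k) t y ≤ √(b / a) * gaussMoment ν (2 * k) b y := by
  have ht := ha.trans_le hat
  unfold gaussMoment
  rw [← integral_const_mul]
  refine integral_mono (integrable_gaussMoment_integrand ν ht _ y)
    ((integrable_gaussMoment_integrand ν (ht.trans_le htb) _ y).const_mul _) fun x => ?_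
  have h : 0 ≤ (y - x) ^ (2 * k) := by rw [pow_mul]; positivity
  calc _ ≤ (y - x) ^ (2 * k) * (√(b / a) * heatKernel b (y - x)) := by
        gcongr; exact heatKernel_le ha hat htb _
    _ = _ := by ring

lemma gaussMoment_zero_pos [IsProbabilityMeasure ν] {t : ℝ} (ht : 0 < t) (y : ℝ) :
    0 < gaussMoment ν 0 t y := by
  have hpos : ∀ x, 0 < (y - x) ^ 0 * heatKernel t (y - x) := fun x => by
    simpa using heatKernel_pos ht _
  refine (integral_pos_iff_support_of_nonneg (fun x => (hpos x).le)
    (integrable_gaussMoment_integrand ν ht 0 y)).2 ?_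
  rw [show Function.support (fun x => (y - x) ^ 0 * heatKernel t (y - x)) = univ from
    eq_univ_of_forall fun x => (hpos x).ne']
  simp

/-- The Cauchy–Schwarz inequality for the Gaussian moments. -/
lemma gaussMoment_sq_le [IsProbabilityMeasure ν] {t : ℝ} (ht : 0 < t) (k : ℕ) (y : ℝ) :
    gaussMoment ν k t y ^ 2 ≤ gaussMoment ν 0 t y * gaussMoment ν (2 * k) t y := by
  have h0 := gaussMoment_zero_pos ν ht y
  -- This `c` is the conditional mean of `(y - x) ^ k`; the inequality is the nonnegativity of the
  -- corresponding weighted variance.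
  set c := gaussMoment ν k t y / gaussMoment ν 0 t y with hc
  have hnn : 0 ≤ ∫ x, ((y - x) ^ k - c) ^ 2 * heatKernel t (y - x) ∂ν :=
    integral_nonneg fun x => mul_nonneg (sq_nonneg _) (heatKernel_nonneg _ _)
  have hexp : ∫ x, ((y - x) ^ k - c) ^ 2 * heatKernel t (y - x) ∂ν
      = gaussMoment ν (2 * k) t y - 2 * c * gaussMoment ν k t y + c ^ 2 * gaussMoment ν 0 t y := by
    have hi := fun k => integrable_gaussMoment_integrand ν ht k y
    have hd : Integrable (fun x => (y - x) ^ (2 * k) * heatKernel t (y - x)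
        - 2 * c * ((y - x) ^ k * heatKernel t (y - x))) ν := (hi _).sub ((hi _).const_mul _)
    unfold gaussMoment
    rw [← integral_const_mul, ← integral_const_mul, ← integral_sub (hi _) ((hi _).const_mul _),
      ← integral_add hd ((hi _).const_mul _)]
    refine integral_congr_ae (.of_forall fun x => ?_)
    simp only [pow_mul']
    ring
  rw [hexp] at hnn
  have hk : gaussMoment ν k t y = c * gaussMoment ν 0 t y := by rw [hc]; field_simp
  rw [hk] at hnn ⊢
  nlinarith

/-- Cauchy–Schwarz for each factor followed by the arithmetic–geometric mean inequality. It replaces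
quotients by even moments, which are integrable in `y` and comparable across times. -/
lemma abs_gaussMoment_mul_div_le [IsProbabilityMeasure ν] {t : ℝ} (ht : 0 < t) (j k : ℕ) (y : ℝ) :
    |gaussMoment ν j t y * gaussMoment ν k t y / gaussMoment ν 0 t y|
      ≤ (gaussMoment ν (2 * j) t y + gaussMoment ν (2 * k) t y) / 2 := by
  have h0 := gaussMoment_zero_pos ν ht y
  have hj := gaussMoment_sq_le ν ht j y
  have hk := gaussMoment_sq_le ν ht k y
  rw [abs_div, abs_of_pos h0, div_le_iff₀ h0, abs_le]
  constructor <;>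
  nlinarith [sq_nonneg (gaussMoment ν j t y + gaussMoment ν k t y),
    sq_nonneg (gaussMoment ν j t y - gaussMoment ν k t y)]

end

/-! ### Derivatives in the noise power of the noise energy and of the entropy -/

section

variable (ν : Measure ℝ)

/-- `E[E[G | Y]²]` where `Y = X + G` with `X` of law `ν` and `G` centred Gaussian of variance `t`. -/
noncomputable def noiseEnergy (t : ℝ) : ℝ :=
  ∫ y, gaussMoment ν 1 t y ^ 2 / gaussMoment ν 0 t y

/-- `E[(Var(G | Y) / t - 1)²]` where `Y = X + G` with `X` of law `ν` and `G` centred Gaussian of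
variance `t`. -/
noncomputable def varianceDefect (t : ℝ) : ℝ :=
  ∫ y, gaussMoment ν 0 t y * ((gaussMoment ν 2 t y / gaussMoment ν 0 t y
    - (gaussMoment ν 1 t y / gaussMoment ν 0 t y) ^ 2) / t - 1) ^ 2

/-- The negative of the differential entropy of the Gaussian smoothing of `ν`. -/
noncomputable def negEntropy (t : ℝ) : ℝ :=
  ∫ y, gaussMoment ν 0 t y * Real.log (gaussMoment ν 0 t y)

variable [IsProbabilityMeasure ν]

lemma abs_gaussMoment_le {t : ℝ} (ht : 0 < t) (k : ℕ) (y : ℝ) :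
    |gaussMoment ν k t y| ≤ (gaussMoment ν 0 t y + gaussMoment ν (2 * k) t y) / 2 := by
  have h := abs_gaussMoment_mul_div_le ν ht 0 k y
  rwa [mul_div_cancel_left₀ _ (gaussMoment_zero_pos ν ht y).ne'] at h

lemma gaussMoment_sq_div_le {t : ℝ} (ht : 0 < t) (k : ℕ) (y : ℝ) :
    gaussMoment ν k t y ^ 2 / gaussMoment ν 0 t y ≤ gaussMoment ν (2 * k) t y := by
  rw [div_le_iff₀' (gaussMoment_zero_pos ν ht y)]
  exact gaussMoment_sq_le ν ht k y

lemma gaussMoment_one_sq_mul_two_le {t : ℝ} (ht : 0 < t) (y : ℝ) :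
    gaussMoment ν 1 t y ^ 2 * gaussMoment ν 2 t y / gaussMoment ν 0 t y ^ 2
      ≤ gaussMoment ν 4 t y := by
  have h0 := gaussMoment_zero_pos ν ht y
  have h2 := gaussMoment_even_nonneg ν 1 t y
  calc _ = gaussMoment ν 1 t y ^ 2 / gaussMoment ν 0 t y * gaussMoment ν 2 t y
        / gaussMoment ν 0 t y := by field_simp
    _ ≤ gaussMoment ν 2 t y * gaussMoment ν 2 t y / gaussMoment ν 0 t y := by
        gcongr
        exact gaussMoment_sq_div_le ν ht 1 y
    _ = gaussMoment ν 2 t y ^ 2 / gaussMoment ν 0 t y := by ring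
    _ ≤ _ := gaussMoment_sq_div_le ν ht 2 y

lemma integrable_noiseEnergy_integrand {t : ℝ} (ht : 0 < t) :
    Integrable (fun y => gaussMoment ν 1 t y ^ 2 / gaussMoment ν 0 t y) := by
  have hc := continuous_gaussMoment ν ht
  refine (integrable_gaussMoment ν ht 2).mono'
    (((hc 1).pow 2).div (hc 0) fun y => (gaussMoment_zero_pos ν ht y).ne').aestronglyMeasurable
    (.of_forall fun y => ?_)
  have h0 := gaussMoment_zero_pos ν ht y
  rw [Real.norm_of_nonneg (by positivity)]
  exact gaussMoment_sq_div_le ν ht 1 y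

/-- The normalized conditional variance `v` satisfies `0 ≤ v ≤ m_2 / (m_0 t)`, so `m_0 (v - 1)² ≤
m_2² / (m_0 t²) + m_0 ≤ m_4 / t² + m_0`. -/
lemma integrable_varianceDefect_integrand {t : ℝ} (ht : 0 < t) :
    Integrable (fun y => gaussMoment ν 0 t y * ((gaussMoment ν 2 t y / gaussMoment ν 0 t y
      - (gaussMoment ν 1 t y / gaussMoment ν 0 t y) ^ 2) / t - 1) ^ 2) := by
  have hc := continuous_gaussMoment ν ht
  have hne : ∀ y, gaussMoment ν 0 t y ≠ 0 := fun y => (gaussMoment_zero_pos ν ht y).ne'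
  refine (((integrable_gaussMoment ν ht 4).const_mul (1 / t ^ 2)).add
    (integrable_gaussMoment ν ht 0)).mono'
    ((hc 0).mul ((((((hc 2).div (hc 0) hne).sub
      (((hc 1).div (hc 0) hne).pow 2)).div_const t).sub
      continuous_const).pow 2)).aestronglyMeasurable
    (.of_forall fun y => ?_)
  have h0 := gaussMoment_zero_pos ν ht y
  have h2 := gaussMoment_even_nonneg ν 1 t y
  have h4 := gaussMoment_sq_div_le ν ht 2 y
  have h1 := gaussMoment_sq_div_le ν ht 1 y
  set m0 := gaussMoment ν 0 t y
  set m1 := gaussMoment ν 1 t y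
  set m2 := gaussMoment ν 2 t y
  simp only [Nat.reduceMul] at h1 h2 h4
  rw [Real.norm_of_nonneg (by positivity)]
  set v := (m2 / m0 - (m1 / m0) ^ 2) / t with hv
  have hv0 : 0 ≤ v := by
    refine div_nonneg ?_ ht.le
    have : m1 ^ 2 / m0 / m0 ≤ m2 / m0 := by gcongr
    rw [div_pow, sq m0, ← div_div]; linarith
  have hv1 : v ≤ m2 / m0 / t := by
    rw [hv]; gcongr; linarith [sq_nonneg (m1 / m0)]
  have hv2 : v ^ 2 ≤ (m2 / m0 / t) ^ 2 := by gcongr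
  calc m0 * (v - 1) ^ 2 ≤ m0 * ((m2 / m0 / t) ^ 2 + 1) := by
        gcongr; nlinarith
    _ = 1 / t ^ 2 * (m2 ^ 2 / m0) + m0 := by field_simp
    _ ≤ _ := by simp only [Pi.add_apply]; gcongr

/-- Differentiating under the integral produces the third moment `m_3`; an integration by parts in
`y` removes it and leaves a perfect square, the variance defect. -/
lemma hasDerivAt_noiseEnergy {t : ℝ} (ht : 0 < t) :
    HasDerivAt (noiseEnergy ν) (2 * noiseEnergy ν t / t - varianceDefect ν t) t := by
  have ht2 : 0 < t / 2 := by positivity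
  -- On the window `[t/2, 2t]` every even moment is at most `c` times its value at time `2t`, by
  -- `gaussMoment_even_le`.
  set c := √(2 * t / (t / 2)) with hc
  have hcont := fun {s : ℝ} (hs : 0 < s) => continuous_gaussMoment ν hs
  have hne : ∀ {s : ℝ}, 0 < s → ∀ y, gaussMoment ν 0 s y ≠ 0 :=
    fun hs y => (gaussMoment_zero_pos ν hs y).ne'
  have key := hasDerivAt_integral_of_dominated_loc_of_deriv_le (μ := (volume : Measure ℝ)) (𝕜 := ℝ)
    (s := Icc (t / 2) (2 * t))
    (x₀ := t) (F := fun t y => gaussMoment ν 1 t y ^ 2 / gaussMoment ν 0 t y)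
    (F' := fun t y => gaussMoment ν 1 t y * gaussMoment ν 3 t y / gaussMoment ν 0 t y / t ^ 2
      - gaussMoment ν 1 t y ^ 2 / gaussMoment ν 0 t y / (2 * t)
      - gaussMoment ν 1 t y ^ 2 * gaussMoment ν 2 t y / gaussMoment ν 0 t y ^ 2 / (2 * t ^ 2))
    (bound := fun y =>
      c * ((gaussMoment ν 2 (2 * t) y + gaussMoment ν 6 (2 * t) y) / 2) / (t / 2) ^ 2
      + c * gaussMoment ν 2 (2 * t) y / (2 * (t / 2))
      + c * gaussMoment ν 4 (2 * t) y / (2 * (t / 2) ^ 2))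
    (Icc_mem_nhds (by linarith) (by linarith)) ?_ (integrable_noiseEnergy_integrand ν ht)
    ?_ (.of_forall fun y s hs => ?_) ?_ (.of_forall fun y s hs => ?_)
  · refine key.2.congr_deriv ?_
    -- `G` is a primitive in `y` of the difference between the differentiated integrand and the
    -- integrand of the claimed value, so that difference integrates to zero.
    set G : ℝ → ℝ := fun y =>
      -(gaussMoment ν 1 t y * gaussMoment ν 2 t y / gaussMoment ν 0 t y) / t + gaussMoment ν 1 t y
        + gaussMoment ν 1 t y ^ 3 / gaussMoment ν 0 t y ^ 2 / (2 * t) with hG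
    set G' : ℝ → ℝ := fun y =>
      (gaussMoment ν 1 t y * gaussMoment ν 3 t y / gaussMoment ν 0 t y / t ^ 2
      - gaussMoment ν 1 t y ^ 2 / gaussMoment ν 0 t y / (2 * t)
      - gaussMoment ν 1 t y ^ 2 * gaussMoment ν 2 t y / gaussMoment ν 0 t y ^ 2 / (2 * t ^ 2))
      - 2 * (gaussMoment ν 1 t y ^ 2 / gaussMoment ν 0 t y) / t
      + gaussMoment ν 0 t y * ((gaussMoment ν 2 t y / gaussMoment ν 0 t y
      - (gaussMoment ν 1 t y / gaussMoment ν 0 t y) ^ 2) / t - 1) ^ 2 with hG'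
    have hi1 := ((integrable_noiseEnergy_integrand ν ht).const_mul 2).div_const t
    have hi2 := integrable_varianceDefect_integrand ν ht
    have hG'int : Integrable G' := (key.1.sub hi1).add hi2
    have hGint : Integrable G := by
      have hm1 : Integrable fun y =>
          (gaussMoment ν 2 t y + gaussMoment ν 4 t y) / 2 :=
        ((integrable_gaussMoment ν ht 2).add (integrable_gaussMoment ν ht 4)).div_const 2
      have hA : Integrable fun y =>
          gaussMoment ν 1 t y * gaussMoment ν 2 t y / gaussMoment ν 0 t y :=
        hm1.mono' ((((hcont ht 1).mul (hcont ht 2)).div (hcont ht 0)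
          (hne ht)).aestronglyMeasurable)
          (.of_forall fun y => abs_gaussMoment_mul_div_le ν ht 1 2 y)
      have hB : Integrable fun y => gaussMoment ν 1 t y ^ 3 / gaussMoment ν 0 t y ^ 2 := by
        refine hm1.mono' ((((hcont ht 1).pow 3).div ((hcont ht 0).pow 2)
          fun y => pow_ne_zero 2 (hne ht y)).aestronglyMeasurable) (.of_forall fun y => ?_)
        have h0 := gaussMoment_zero_pos ν ht y
        have h1 := gaussMoment_sq_div_le ν ht 1 y
        have h12 := abs_gaussMoment_mul_div_le ν ht 1 2 y
        have h2 := gaussMoment_even_nonneg ν 1 t y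
        rw [abs_div, abs_mul, abs_of_pos h0, abs_of_nonneg (a := gaussMoment ν 2 t y) h2] at h12
        rw [Real.norm_eq_abs, abs_div, abs_pow, abs_of_pos (pow_pos h0 2)]
        calc |gaussMoment ν 1 t y| ^ 3 / gaussMoment ν 0 t y ^ 2
            = |gaussMoment ν 1 t y| * (|gaussMoment ν 1 t y| ^ 2 / gaussMoment ν 0 t y)
              / gaussMoment ν 0 t y := by field_simp
          _ ≤ |gaussMoment ν 1 t y| * gaussMoment ν 2 t y / gaussMoment ν 0 t y := by
              rw [sq_abs]; gcongr
          _ ≤ _ := h12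
      have hm : Integrable (gaussMoment ν 1 t) := integrable_gaussMoment ν ht 1
      exact ((hA.neg.div_const t).add hm).add (hB.div_const _)
    have hderiv : ∀ y, HasDerivAt G (G' y) y := by
      intro y
      have h0 := hasDerivAt_gaussMoment_space ν ht 0 y
      have h1 := hasDerivAt_gaussMoment_space ν ht 1 y
      have h2 := hasDerivAt_gaussMoment_space ν ht 2 y
      have h0' := hne ht y
      have h := (((((h1.mul h2).div h0 h0').neg.div_const t).add h1).add
        (((h1.pow 3).div (h0.pow 2) (pow_ne_zero 2 h0')).div_const (2 * t)))
      refine h.congr_deriv ?_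
      simp only [hG', Pi.pow_apply, Pi.mul_apply]
      norm_num
      field_simp
      ring
    have hzero := integral_eq_zero_of_hasDerivAt_of_integrable hderiv hG'int hGint
    have hsplit : ∫ y, G' y = (∫ y, (gaussMoment ν 1 t y * gaussMoment ν 3 t y
        / gaussMoment ν 0 t y / t ^ 2 - gaussMoment ν 1 t y ^ 2 / gaussMoment ν 0 t y / (2 * t)
        - gaussMoment ν 1 t y ^ 2 * gaussMoment ν 2 t y / gaussMoment ν 0 t y ^ 2 / (2 * t ^ 2)))
        - 2 * noiseEnergy ν t / t + varianceDefect ν t := by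
      have hd := key.1.sub hi1
      simp only [Pi.sub_def] at hd
      rw [hG', integral_add hd hi2, integral_sub key.1 hi1, integral_div, integral_const_mul]
      rfl
    rw [hzero] at hsplit
    linarith
  · filter_upwards [lt_mem_nhds ht] with s hs
    exact (((hcont hs 1).pow 2).div (hcont hs 0) (hne hs)).aestronglyMeasurable
  · exact ((((((hcont ht 1).mul (hcont ht 3)).div (hcont ht 0) (hne ht)).div_const _).sub
      ((((hcont ht 1).pow 2).div (hcont ht 0) (hne ht)).div_const _)).sub
      (((((hcont ht 1).pow 2).mul (hcont ht 2)).div ((hcont ht 0).pow 2)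
        fun y => pow_ne_zero 2 (hne ht y)).div_const _)).aestronglyMeasurable
  · have hs0 : 0 < s := ht2.trans_le hs.1
    have hle := fun k => gaussMoment_even_le ν ht2 hs.1 hs.2 k y
    have h2 := hle 1
    have h4 := hle 2
    have h6 := hle 3
    simp only [mul_one, Nat.reduceMul, ← hc] at h2 h4 h6
    have hpos := gaussMoment_zero_pos ν hs0 y
    have hpos2 := gaussMoment_even_nonneg ν 1 s y
    have hpos4 := gaussMoment_even_nonneg ν 2 s y
    have hpos6 := gaussMoment_even_nonneg ν 3 s y
    simp only [mul_one, Nat.reduceMul] at hpos2 hpos4 hpos6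
    have hs1 := hs.1
    refine (norm_sub_le _ _).trans (add_le_add ((norm_sub_le _ _).trans (add_le_add ?_ ?_)) ?_)
    · rw [norm_div, Real.norm_of_nonneg (by positivity : 0 ≤ s ^ 2)]
      have h := (abs_gaussMoment_mul_div_le ν hs0 1 3 y)
      simp only [mul_one, Nat.reduceMul] at h
      refine div_le_div₀ (by linarith) (h.trans (by linarith)) (by positivity) (by gcongr)
    · rw [Real.norm_of_nonneg (by positivity)]
      have h := gaussMoment_sq_div_le ν hs0 1 y
      exact div_le_div₀ (by linarith) (h.trans h2) (by positivity) (by gcongr)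
    · rw [Real.norm_of_nonneg (by positivity)]
      have h := gaussMoment_one_sq_mul_two_le ν hs0 y
      exact div_le_div₀ (by linarith) (h.trans h4) (by positivity) (by gcongr)
  · have ht' : 0 < 2 * t := by positivity
    have hi := integrable_gaussMoment ν ht'
    exact (((((hi 2).add (hi 6)).div_const 2).const_mul c).div_const _ |>.add
      (((hi 2).const_mul c).div_const _)).add (((hi 4).const_mul c).div_const _)
  · have hs0 : 0 < s := ht2.trans_le hs.1
    have h0 := hasDerivAt_gaussMoment_time ν hs0 0 y
    have h1 := hasDerivAt_gaussMoment_time ν hs0 1 y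
    refine ((h1.pow 2).div h0 (hne hs0 y)).congr_deriv ?_
    have := hne hs0 y
    simp only [Pi.pow_apply]
    norm_num
    field_simp
    ring

/-- The density is at most the maximum of the kernel. From below, `(y - x)² ≤ 2(x² + y²)` gives a
constant times `κ exp(-y²/a)` with `κ = E[exp(-X²/a)] > 0`. The logarithm thus grows at most
quadratically, and a finite second moment of the input suffices. -/
lemma exists_abs_log_gaussMoment_le {a b : ℝ} (ha : 0 < a) :
    ∃ C, ∀ t, a ≤ t → t ≤ b → ∀ y, |Real.log (gaussMoment ν 0 t y)| ≤ C + y ^ 2 / a := by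
  set κ := ∫ x, Real.exp (-x ^ 2 / a) ∂ν with hκdef
  have hκint : Integrable (fun x => Real.exp (-x ^ 2 / a)) ν := by
    refine Integrable.of_bound (C := 1) (by fun_prop) (.of_forall fun x => ?_)
    rw [Real.norm_of_nonneg (Real.exp_pos _).le, Real.exp_le_one_iff]
    exact div_nonpos_of_nonpos_of_nonneg (by nlinarith [sq_nonneg x]) ha.le
  have hκ : 0 < κ := integral_exp_pos hκint
  refine ⟨|Real.log (√(2 * Real.pi * a))⁻¹| + |Real.log ((√(2 * Real.pi * b))⁻¹ * κ)|,
    fun t hat htb y => ?_⟩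
  have ht := ha.trans_le hat
  have hb := ht.trans_le htb
  have hM := gaussMoment_zero_pos ν ht y
  have hup : gaussMoment ν 0 t y ≤ (√(2 * Real.pi * a))⁻¹ := by
    calc gaussMoment ν 0 t y ≤ ∫ _, (√(2 * Real.pi * a))⁻¹ ∂ν := by
          refine integral_mono (integrable_gaussMoment_integrand ν ht 0 y) (integrable_const _)
            fun x => ?_
          rw [pow_zero, one_mul]
          exact (heatKernel_le_const _ ht.le).trans (by gcongr)
      _ = _ := by simp
  have hlow : (√(2 * Real.pi * b))⁻¹ * κ * Real.exp (-y ^ 2 / a) ≤ gaussMoment ν 0 t y := by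
    rw [hκdef, ← integral_const_mul, ← integral_mul_const]
    refine integral_mono ((hκint.const_mul _).mul_const _)
      (integrable_gaussMoment_integrand ν ht 0 y) fun x => ?_
    simp only [pow_zero, one_mul, heatKernel]
    rw [mul_assoc, ← Real.exp_add]
    have h1 : -x ^ 2 / a + -y ^ 2 / a ≤ -(y - x) ^ 2 / (2 * t) := by
      have : (y - x) ^ 2 / (2 * t) ≤ (2 * (x ^ 2 + y ^ 2)) / (2 * a) := by
        gcongr; nlinarith [sq_nonneg (x + y)]
      have e : (2 * (x ^ 2 + y ^ 2)) / (2 * a) = x ^ 2 / a + y ^ 2 / a := by field_simp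
      rw [neg_div, neg_div, neg_div]; linarith
    gcongr
  have h1 := Real.log_le_log hM hup
  have h2 := Real.log_le_log (by positivity) hlow
  rw [Real.log_mul (by positivity) (Real.exp_pos _).ne', Real.log_exp, neg_div] at h2
  have hy : 0 ≤ y ^ 2 / a := by positivity
  rw [abs_le]
  constructor
  · linarith [neg_abs_le (Real.log ((√(2 * Real.pi * b))⁻¹ * κ)),
      abs_nonneg (Real.log (√(2 * Real.pi * a))⁻¹)]
  · linarith [le_abs_self (Real.log (√(2 * Real.pi * a))⁻¹),
      abs_nonneg (Real.log ((√(2 * Real.pi * b))⁻¹ * κ))]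

variable {ν} in
lemma integrable_sq_mul_gaussMoment (hν : MemLp id 2 ν) {t : ℝ} (ht : 0 < t) (k : ℕ) :
    Integrable (fun y => y ^ 2 * gaussMoment ν k t y) := by
  have h1 : Integrable (fun x : ℝ => x) ν := hν.integrable one_le_two
  have h2 : Integrable (fun x : ℝ => x ^ 2) ν := hν.integrable_sq
  -- Expand `y² = (y - x)² + 2x(y - x) + x²`; the finite power of the input is used for the last two
  -- terms.
  have h := ((integrable_prod_pow_mul_heatKernel ν ht (k + 2) (integrable_const (1 : ℝ))).add
    (integrable_prod_pow_mul_heatKernel ν ht (k + 1) (h1.const_mul 2))).add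
    (integrable_prod_pow_mul_heatKernel ν ht k h2)
  refine h.integral_prod_right.congr (.of_forall fun y => ?_)
  simp only [gaussMoment, ← integral_const_mul, Pi.add_apply]
  refine integral_congr_ae (.of_forall fun x => ?_)
  simp only
  ring

variable {ν} in
lemma integrable_mul_gaussMoment (hν : MemLp id 2 ν) {t : ℝ} (ht : 0 < t) (k : ℕ) (C a : ℝ) :
    Integrable (fun y => (C + y ^ 2 / a) * gaussMoment ν k t y) := by
  refine (((integrable_gaussMoment ν ht k).const_mul C).add
    ((integrable_sq_mul_gaussMoment hν ht k).div_const a)).congr (.of_forall fun y => ?_)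
  simp only [Pi.add_apply]
  ring

variable {ν} in
lemma integrable_negEntropy_integrand (hν : MemLp id 2 ν) {t : ℝ} (ht : 0 < t) :
    Integrable (fun y => gaussMoment ν 0 t y * Real.log (gaussMoment ν 0 t y)) := by
  obtain ⟨C, hC⟩ := exists_abs_log_gaussMoment_le ν (b := t) ht
  have hc := continuous_gaussMoment ν ht 0
  refine (integrable_mul_gaussMoment hν ht 0 C t).mono'
    (hc.mul (hc.log fun y => (gaussMoment_zero_pos ν ht y).ne')).aestronglyMeasurable
    (.of_forall fun y => ?_)
  rw [norm_mul, Real.norm_of_nonneg (gaussMoment_zero_pos ν ht y).le, mul_comm]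
  have := gaussMoment_zero_pos ν ht y
  gcongr
  exact hC t le_rfl le_rfl y

variable {ν} in
-- De Bruijn's identity: the Fisher information of the smoothed density is `noiseEnergy ν t / t ^
-- 2`.
lemma hasDerivAt_negEntropy (hν : MemLp id 2 ν) {t : ℝ} (ht : 0 < t) :
    HasDerivAt (negEntropy ν) (-(noiseEnergy ν t / (2 * t ^ 2))) t := by
  have ht2 : 0 < t / 2 := by positivity
  set c := √(2 * t / (t / 2)) with hc
  obtain ⟨C, hC⟩ := exists_abs_log_gaussMoment_le ν (b := 2 * t) ht2
  have hcont := fun {s : ℝ} (hs : 0 < s) => continuous_gaussMoment ν hs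
  have hne : ∀ {s : ℝ}, 0 < s → ∀ y, gaussMoment ν 0 s y ≠ 0 :=
    fun hs y => (gaussMoment_zero_pos ν hs y).ne'
  have key := hasDerivAt_integral_of_dominated_loc_of_deriv_le (μ := (volume : Measure ℝ)) (𝕜 := ℝ)
    (s := Icc (t / 2) (2 * t))
    (x₀ := t) (F := fun t y => gaussMoment ν 0 t y * Real.log (gaussMoment ν 0 t y))
    (F' := fun t y => (Real.log (gaussMoment ν 0 t y) + 1)
      * (gaussMoment ν 2 t y / (2 * t ^ 2) - gaussMoment ν 0 t y / (2 * t)))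
    (bound := fun y => (C + 1 + y ^ 2 / (t / 2)) *
      (c * gaussMoment ν 2 (2 * t) y / (2 * (t / 2) ^ 2)
        + c * gaussMoment ν 0 (2 * t) y / (2 * (t / 2))))
    (Icc_mem_nhds (by linarith) (by linarith)) ?_ (integrable_negEntropy_integrand hν ht)
    ?_ (.of_forall fun y s hs => ?_) ?_ (.of_forall fun y s hs => ?_)
  · refine key.2.congr_deriv ?_
    -- `G` is `∂_y (m_0 log m_0)`. By the heat equation its derivative is twice the time derivative
    -- of `m_0 log m_0` plus `(∂_y m_0)² / m_0`.
    set G : ℝ → ℝ := fun y =>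
      -(gaussMoment ν 1 t y / t) * (Real.log (gaussMoment ν 0 t y) + 1) with hG
    set G' : ℝ → ℝ := fun y => 2 * ((Real.log (gaussMoment ν 0 t y) + 1)
      * (gaussMoment ν 2 t y / (2 * t ^ 2) - gaussMoment ν 0 t y / (2 * t)))
      + gaussMoment ν 1 t y ^ 2 / gaussMoment ν 0 t y / t ^ 2 with hG'
    have hi1 := (integrable_noiseEnergy_integrand ν ht).div_const (t ^ 2)
    have hG'int : Integrable G' := (key.1.const_mul 2).add hi1
    have hGint : Integrable G := by
      have hi := fun k => (integrable_mul_gaussMoment hν ht k (C + 1) (t / 2)).div_const (2 * t)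
      refine ((hi 0).add (hi 2)).mono'
        (((hcont ht 1).div_const t).neg.mul
          (((hcont ht 0).log (hne ht)).add continuous_const)).aestronglyMeasurable
        (.of_forall fun y => ?_)
      have h1 := abs_gaussMoment_le ν ht 1 y
      have h2 := hC t (by linarith) (by linarith) y
      have h3 : |Real.log (gaussMoment ν 0 t y) + 1| ≤ C + 1 + y ^ 2 / (t / 2) :=
        (abs_add_le _ _).trans (by rw [abs_one]; linarith)
      have h4 : 0 ≤ C + 1 + y ^ 2 / (t / 2) := (abs_nonneg _).trans h3
      simp only [hG, Pi.add_apply]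
      rw [norm_mul, norm_neg, norm_div, Real.norm_of_nonneg ht.le, Real.norm_eq_abs,
        Real.norm_eq_abs]
      calc _ ≤ ((gaussMoment ν 0 t y + gaussMoment ν (2 * 1) t y) / 2) / t
            * (C + 1 + y ^ 2 / (t / 2)) := by
              gcongr
              exact div_nonneg ((abs_nonneg _).trans h1) ht.le
        _ = _ := by field_simp
    have hderiv : ∀ y, HasDerivAt G (G' y) y := by
      intro y
      have h0 := hasDerivAt_gaussMoment_space ν ht 0 y
      have h1 := hasDerivAt_gaussMoment_space ν ht 1 y
      have h0' := hne ht y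
      have h := (h1.div_const t).neg.mul ((h0.log h0').add_const 1)
      refine h.congr_deriv ?_
      simp only [hG', Pi.neg_apply]
      norm_num
      field_simp
      ring
    have hzero := integral_eq_zero_of_hasDerivAt_of_integrable hderiv hG'int hGint
    rw [hG', integral_add (key.1.const_mul 2) hi1, integral_const_mul, integral_div] at hzero
    change _ + noiseEnergy ν t / t ^ 2 = 0 at hzero
    have e : noiseEnergy ν t / (2 * t ^ 2) = noiseEnergy ν t / t ^ 2 / 2 := by field_simp
    rw [e]
    linarith
  · filter_upwards [lt_mem_nhds ht] with s hs
    exact ((hcont hs 0).mul ((hcont hs 0).log (hne hs))).aestronglyMeasurable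
  · exact ((((hcont ht 0).log (hne ht)).add continuous_const).mul
      (((hcont ht 2).div_const _).sub ((hcont ht 0).div_const _))).aestronglyMeasurable
  · have hs0 : 0 < s := ht2.trans_le hs.1
    have hs1 := hs.1
    have hle := fun k => gaussMoment_even_le ν ht2 hs.1 hs.2 k y
    have h2 := hC s hs.1 hs.2 y
    have h3 : |Real.log (gaussMoment ν 0 s y) + 1| ≤ C + 1 + y ^ 2 / (t / 2) :=
      (abs_add_le _ _).trans (by rw [abs_one]; linarith)
    rw [norm_mul]
    refine mul_le_mul h3 ((norm_sub_le _ _).trans (add_le_add ?_ ?_)) (norm_nonneg _)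
      ((abs_nonneg _).trans h3)
    · have hn := gaussMoment_even_nonneg ν 1 s y
      rw [Real.norm_of_nonneg (div_nonneg hn (by positivity))]
      exact div_le_div₀ (hn.trans (hle 1)) (hle 1) (by positivity) (by gcongr)
    · have hn := gaussMoment_even_nonneg ν 0 s y
      rw [Real.norm_of_nonneg (div_nonneg hn (by positivity))]
      exact div_le_div₀ (hn.trans (hle 0)) (hle 0) (by positivity) (by gcongr)
  · have ht' : 0 < 2 * t := by positivity
    have hi := fun k => integrable_mul_gaussMoment hν ht' k (C + 1) (t / 2)
    refine (((hi 2).const_mul (c / (2 * (t / 2) ^ 2))).add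
      ((hi 0).const_mul (c / (2 * (t / 2))))).congr (.of_forall fun y => ?_)
    simp only [Pi.add_apply]
    ring
  · have hs0 : 0 < s := ht2.trans_le hs.1
    have h0 := hasDerivAt_gaussMoment_time ν hs0 0 y
    have h0' := hne hs0 y
    refine (h0.mul (h0.log h0')).congr_deriv ?_
    norm_num
    field_simp

end

/-! ### Gaussian channel: joint law, mutual information, conditional expectation -/

section

/-- The law of total variance. -/
lemma integral_sub_condExp_sq_eq {Ω : Type*} {m m₀ : MeasurableSpace Ω} {μ : Measure Ω}
    [IsProbabilityMeasure μ] (hm : m ≤ m₀) {G : Ω → ℝ} (hG : MemLp G 2 μ) :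
    ∫ ω, (G ω - (μ[G | m]) ω) ^ 2 ∂μ
      = Var[G; μ] + (∫ ω, G ω ∂μ) ^ 2 - ∫ ω, (μ[G | m]) ω ^ 2 ∂μ := by
  have h2 : ∫ ω, (G ω - (μ[G | m]) ω) ^ 2 ∂μ = ∫ ω, (Var[G; μ | m]) ω ∂μ :=
    (integral_condExp hm).symm
  have h3 := integral_condVar_add_variance_condExp hm hG
  rw [variance_eq_sub (hG.condExp (m := m) one_le_two), integral_condExp hm] at h3
  simp only [Pi.pow_apply] at h3
  rw [h2]
  linarith

section AdditiveNoise

variable {Ω : Type*} [MeasurableSpace Ω] {μ : Measure Ω} {X G : Ω → ℝ} {t : ℝ}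

lemma memLp_gaussian (hG : HasLaw G (gaussianReal 0 t.toNNReal) μ) : MemLp G 2 μ := by
  have h := memLp_id_gaussianReal (μ := 0) (v := t.toNNReal) 2
  rw [← hG.map_eq] at h
  exact (memLp_map_measure_iff aestronglyMeasurable_id hG.aemeasurable).1 h

lemma integral_gaussian (hG : HasLaw G (gaussianReal 0 t.toNNReal) μ) : ∫ ω, G ω ∂μ = 0 := by
  rw [hG.integral_eq]; simp

lemma variance_gaussian (ht : 0 ≤ t) (hG : HasLaw G (gaussianReal 0 t.toNNReal) μ) :
    Var[G; μ] = t := by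
  rw [hG.variance_eq, variance_id_gaussianReal, Real.coe_toNNReal _ ht]

variable [IsProbabilityMeasure μ]

lemma integral_gaussian_sq (ht : 0 ≤ t) (hG : HasLaw G (gaussianReal 0 t.toNNReal) μ) :
    ∫ ω, G ω ^ 2 ∂μ = t := by
  have h := variance_eq_sub (memLp_gaussian hG)
  rw [variance_gaussian ht hG, integral_gaussian hG] at h
  simpa using h.symm

lemma measurable_gaussMoment (ν : Measure ℝ) [IsFiniteMeasure ν] (ht : 0 < t) (k : ℕ) :
    Measurable (gaussMoment ν k t) :=
  (continuous_gaussMoment ν ht k).measurable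

/-- The joint law of the input `X` and the output `X + G` of a Gaussian channel. -/
lemma map_prodMk_add (ht : 0 < t) (hX : Measurable X)
    (hG : HasLaw G (gaussianReal 0 t.toNNReal) μ) (hXG : IndepFun X G μ) :
    μ.map (fun ω => (X ω, X ω + G ω))
      = ((μ.map X).prod volume).withDensity
        (fun p => ENNReal.ofReal (heatKernel t (p.2 - p.1))) := by
  have : IsProbabilityMeasure (μ.map X) := Measure.isProbabilityMeasure_map hX.aemeasurable
  have hv : t.toNNReal ≠ 0 := by simpa using ht
  have hjoint : μ.map (fun ω => (X ω, G ω)) = (μ.map X).prod (gaussianReal 0 t.toNNReal) := by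
    rw [← hG.map_eq]
    exact (indepFun_iff_map_prod_eq_prod_map_map hX.aemeasurable hG.aemeasurable).1 hXG
  have hmp := measurePreserving_prod_add (μ.map X) (volume : Measure ℝ)
  have hcomp : (fun ω => (X ω, X ω + G ω))
      = (fun p : ℝ × ℝ => (p.1, p.1 + p.2)) ∘ (fun ω => (X ω, G ω)) := rfl
  have hpdf : gaussianPDF 0 t.toNNReal = fun z => ENNReal.ofReal (heatKernel t z) := by
    ext z
    rw [gaussianPDF, gaussianPDFReal_eq_heatKernel, Real.coe_toNNReal _ ht.le, sub_zero]
  have hmeas : Measurable fun z => ENNReal.ofReal (heatKernel t z) := by fun_prop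
  have hmeas' : Measurable fun p : ℝ × ℝ => ENNReal.ofReal (heatKernel t (p.2 - p.1)) := by fun_prop
  rw [hcomp, ← AEMeasurable.map_map_of_aemeasurable hmp.measurable.aemeasurable
    (hX.aemeasurable.prodMk hG.aemeasurable), hjoint, gaussianReal_of_var_ne_zero 0 hv, hpdf,
    prod_withDensity_right hmeas]
  ext A hA
  rw [Measure.map_apply hmp.measurable hA, withDensity_apply _ (hmp.measurable hA),
    withDensity_apply _ hA, ← hmp.setLIntegral_comp_preimage hA hmeas']
  simp

lemma integrable_prodMk_add_iff (ht : 0 < t) (hX : Measurable X)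
    (hG : HasLaw G (gaussianReal 0 t.toNNReal) μ) (hXG : IndepFun X G μ)
    {F : ℝ × ℝ → ℝ} (hF : Measurable F) :
    Integrable (fun ω => F (X ω, X ω + G ω)) μ ↔
      Integrable (fun p => F p * heatKernel t (p.2 - p.1)) ((μ.map X).prod volume) := by
  have hXY : AEMeasurable (fun ω => (X ω, X ω + G ω)) μ :=
    hX.aemeasurable.prodMk (hX.aemeasurable.add hG.aemeasurable)
  have h := integrable_map_measure (f := fun ω => (X ω, X ω + G ω)) (μ := μ) (g := F)
    hF.aestronglyMeasurable hXY
  rw [map_prodMk_add ht hX hG hXG, integrable_withDensity_iff_integrable_smul' (by fun_prop)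
    (.of_forall fun _ => ENNReal.ofReal_lt_top)] at h
  refine h.symm.trans (iff_of_eq ?_)
  congr 1
  ext p
  rw [ENNReal.toReal_ofReal (heatKernel_nonneg _ _), smul_eq_mul, mul_comm]

lemma integral_prodMk_add (ht : 0 < t) (hX : Measurable X)
    (hG : HasLaw G (gaussianReal 0 t.toNNReal) μ) (hXG : IndepFun X G μ)
    {F : ℝ × ℝ → ℝ} (hF : Measurable F) (hFi : Integrable (fun ω => F (X ω, X ω + G ω)) μ) :
    ∫ ω, F (X ω, X ω + G ω) ∂μ
      = ∫ y, ∫ x, F (x, y) * heatKernel t (y - x) ∂(μ.map X) := by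
  have : IsProbabilityMeasure (μ.map X) := Measure.isProbabilityMeasure_map hX.aemeasurable
  have hXY : AEMeasurable (fun ω => (X ω, X ω + G ω)) μ :=
    hX.aemeasurable.prodMk (hX.aemeasurable.add hG.aemeasurable)
  rw [← integral_map (f := F) hXY hF.aestronglyMeasurable, map_prodMk_add ht hX hG hXG,
    integral_withDensity_eq_integral_toReal_smul (by fun_prop)
      (.of_forall fun _ => ENNReal.ofReal_lt_top),
    ← integral_prod_symm _ ((integrable_prodMk_add_iff ht hX hG hXG hF).1 hFi)]
  refine integral_congr_ae (.of_forall fun p => ?_)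
  simp only [smul_eq_mul]
  rw [ENNReal.toReal_ofReal (heatKernel_nonneg _ _), mul_comm]

/-- The law of the output `X + G` of a Gaussian channel. -/
lemma map_add (ht : 0 < t) (hX : Measurable X)
    (hG : HasLaw G (gaussianReal 0 t.toNNReal) μ) (hXG : IndepFun X G μ) :
    μ.map (fun ω => X ω + G ω)
      = volume.withDensity (fun y => ENNReal.ofReal (gaussMoment (μ.map X) 0 t y)) := by
  have : IsProbabilityMeasure (μ.map X) := Measure.isProbabilityMeasure_map hX.aemeasurable
  have hXY : AEMeasurable (fun ω => (X ω, X ω + G ω)) μ :=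
    hX.aemeasurable.prodMk (hX.aemeasurable.add hG.aemeasurable)
  have hcomp : (fun ω => X ω + G ω) = Prod.snd ∘ (fun ω => (X ω, X ω + G ω)) := rfl
  have hmeas : Measurable fun p : ℝ × ℝ => ENNReal.ofReal (heatKernel t (p.2 - p.1)) := by fun_prop
  rw [hcomp, ← AEMeasurable.map_map_of_aemeasurable measurable_snd.aemeasurable hXY,
    map_prodMk_add ht hX hG hXG]
  ext A hA
  rw [Measure.map_apply measurable_snd hA, withDensity_apply _ (measurable_snd hA),
    withDensity_apply _ hA, ← lintegral_indicator (measurable_snd hA), ← lintegral_indicator hA,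
    lintegral_prod_symm _ (hmeas.indicator (measurable_snd hA)).aemeasurable]
  refine lintegral_congr fun y => ?_
  by_cases hy : y ∈ A
  · rw [indicator_of_mem hy, gaussMoment, ofReal_integral_eq_lintegral_ofReal
      (integrable_gaussMoment_integrand _ ht 0 y)
      (.of_forall fun x => by simpa using heatKernel_nonneg _ _)]
    simp [indicator, hy]
  · simp [indicator, hy]

lemma integrable_comp_add_iff (ht : 0 < t) (hX : Measurable X)
    (hG : HasLaw G (gaussianReal 0 t.toNNReal) μ) (hXG : IndepFun X G μ)
    {g : ℝ → ℝ} (hg : Measurable g) :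
    Integrable (fun ω => g (X ω + G ω)) μ ↔
      Integrable (fun y => gaussMoment (μ.map X) 0 t y * g y) := by
  have : IsProbabilityMeasure (μ.map X) := Measure.isProbabilityMeasure_map hX.aemeasurable
  have h := integrable_map_measure (f := fun ω => X ω + G ω) (μ := μ) (g := g)
    hg.aestronglyMeasurable (hX.aemeasurable.add hG.aemeasurable)
  rw [map_add ht hX hG hXG, integrable_withDensity_iff_integrable_smul'
    (measurable_gaussMoment _ ht 0).ennreal_ofReal
    (.of_forall fun _ => ENNReal.ofReal_lt_top)] at h
  refine h.symm.trans (iff_of_eq ?_)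
  congr 1
  ext y
  rw [ENNReal.toReal_ofReal (gaussMoment_zero_pos _ ht y).le, smul_eq_mul]

lemma integral_comp_add (ht : 0 < t) (hX : Measurable X)
    (hG : HasLaw G (gaussianReal 0 t.toNNReal) μ) (hXG : IndepFun X G μ)
    {g : ℝ → ℝ} (hg : Measurable g) :
    ∫ ω, g (X ω + G ω) ∂μ = ∫ y, gaussMoment (μ.map X) 0 t y * g y := by
  have : IsProbabilityMeasure (μ.map X) := Measure.isProbabilityMeasure_map hX.aemeasurable
  rw [← integral_map (φ := fun ω => X ω + G ω) (f := g) (hX.aemeasurable.add hG.aemeasurable)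
    hg.aestronglyMeasurable, map_add ht hX hG hXG,
    integral_withDensity_eq_integral_toReal_smul (measurable_gaussMoment _ ht 0).ennreal_ofReal
      (.of_forall fun _ => ENNReal.ofReal_lt_top)]
  refine integral_congr_ae (.of_forall fun y => ?_)
  simp only [smul_eq_mul]
  rw [ENNReal.toReal_ofReal (gaussMoment_zero_pos _ ht y).le]

/-- The mutual information between the input and the output of a Gaussian channel. -/
lemma mutualInfo_add (ht : 0 < t) (hX : Measurable X) (hX2 : MemLp X 2 μ)
    (hG : HasLaw G (gaussianReal 0 t.toNNReal) μ) (hXG : IndepFun X G μ) :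
    mutualInfo μ X (fun ω => X ω + G ω) ≠ ∞ ∧
    (mutualInfo μ X (fun ω => X ω + G ω)).toReal
      = -(Real.log (2 * Real.pi * t) / 2) - 1 / 2 - negEntropy (μ.map X) t := by
  have hP : IsProbabilityMeasure (μ.map X) := Measure.isProbabilityMeasure_map hX.aemeasurable
  have hXY : AEMeasurable (fun ω => (X ω, X ω + G ω)) μ :=
    hX.aemeasurable.prodMk (hX.aemeasurable.add hG.aemeasurable)
  have hν : MemLp id 2 (μ.map X) :=
    (memLp_map_measure_iff aestronglyMeasurable_id hX.aemeasurable).2 hX2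
  have hPXY : IsProbabilityMeasure (μ.map (fun ω => (X ω, X ω + G ω))) :=
    Measure.isProbabilityMeasure_map hXY
  have hPY : IsProbabilityMeasure (μ.map (fun ω => X ω + G ω)) :=
    Measure.isProbabilityMeasure_map (hX.aemeasurable.add hG.aemeasurable)
  have hm0 := measurable_gaussMoment (μ.map X) ht 0
  have hpos := gaussMoment_zero_pos (μ.map X) ht
  set Q := (μ.map X).prod (μ.map (fun ω => X ω + G ω)) with hQ
  -- The density of the joint law with respect to the product of the marginals: conditional output
  -- density over output density.
  set r : ℝ × ℝ → ℝ := fun p => heatKernel t (p.2 - p.1) / gaussMoment (μ.map X) 0 t p.2 with hr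
  have hrm : Measurable r := by
    refine Measurable.div (by fun_prop) (hm0.comp measurable_snd)
  have hdens : μ.map (fun ω => (X ω, X ω + G ω)) = Q.withDensity (fun p => ENNReal.ofReal (r p)) := by
    rw [hQ, map_add ht hX hG hXG, prod_withDensity_right hm0.ennreal_ofReal,
      ← withDensity_mul _ (f := fun p : ℝ × ℝ => ENNReal.ofReal (gaussMoment (μ.map X) 0 t p.2))
        (hm0.ennreal_ofReal.comp measurable_snd) hrm.ennreal_ofReal,
      map_prodMk_add ht hX hG hXG]
    congr 1
    ext p
    simp only [Pi.mul_apply, hr]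
    rw [← ENNReal.ofReal_mul (hpos _).le, mul_div_cancel₀ _ (hpos _).ne']
  have hac : μ.map (fun ω => (X ω, X ω + G ω)) ≪ Q := by
    rw [hdens]; exact withDensity_absolutelyContinuous _ _
  have hllr : llr (μ.map (fun ω => (X ω, X ω + G ω))) Q
      =ᵐ[μ.map (fun ω => (X ω, X ω + G ω))] fun p => Real.log (r p) := by
    refine hac.ae_le ?_
    have h := Measure.rnDeriv_withDensity Q hrm.ennreal_ofReal
    rw [← hdens] at h
    filter_upwards [h] with p hp
    rw [llr, hp, ENNReal.toReal_ofReal (div_nonneg (heatKernel_nonneg _ _) (hpos _).le)]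
  have hlogr : ∀ ω, Real.log (r (X ω, X ω + G ω)) = -(Real.log (2 * Real.pi * t) / 2)
      - G ω ^ 2 / (2 * t) - Real.log (gaussMoment (μ.map X) 0 t (X ω + G ω)) := by
    intro ω
    simp only [hr]
    rw [Real.log_div (heatKernel_pos ht _).ne' (hpos _).ne', log_heatKernel ht,
      add_sub_cancel_left]
  have hi1 : Integrable (fun ω => G ω ^ 2 / (2 * t)) μ :=
    (memLp_gaussian hG).integrable_sq.div_const _
  have hi2 : Integrable (fun ω => Real.log (gaussMoment (μ.map X) 0 t (X ω + G ω))) μ :=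
    (integrable_comp_add_iff ht hX hG hXG hm0.log).2 (integrable_negEntropy_integrand hν ht)
  have hi0 : Integrable (fun ω => -(Real.log (2 * Real.pi * t) / 2) - G ω ^ 2 / (2 * t)) μ :=
    (integrable_const _).sub hi1
  have hint : Integrable (fun ω => Real.log (r (X ω, X ω + G ω))) μ := by
    simp only [hlogr]
    exact hi0.sub hi2
  have hint' : Integrable (llr (μ.map (fun ω => (X ω, X ω + G ω))) Q)
      (μ.map (fun ω => (X ω, X ω + G ω))) :=
    ((integrable_map_measure hrm.log.aestronglyMeasurable hXY).2 hint).congr hllr.symm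
  refine ⟨InformationTheory.klDiv_ne_top hac hint', ?_⟩
  unfold mutualInfo
  -- Both measures have mass one, so the divergence is just the integral of the log-likelihood
  -- ratio.
  rw [InformationTheory.toReal_klDiv_of_measure_eq hac (by simp), integral_congr_ae hllr,
    integral_map hXY hrm.log.aestronglyMeasurable]
  simp only [hlogr]
  rw [integral_sub hi0 hi2, integral_sub (integrable_const _) hi1, integral_div,
    integral_gaussian_sq ht.le hG,
    integral_comp_add (g := fun y => Real.log (gaussMoment (μ.map X) 0 t y)) ht hX hG hXG hm0.log]
  simp only [integral_const, probReal_univ, one_smul, negEntropy]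
  field_simp

/-- The conditional expectation of the noise given the output. -/
lemma condExp_noise (ht : 0 < t) (hX : Measurable X) (hGm : Measurable G)
    (hG : HasLaw G (gaussianReal 0 t.toNNReal) μ) (hXG : IndepFun X G μ) :
    μ[G | MeasurableSpace.comap (fun ω => X ω + G ω) inferInstance]
      =ᵐ[μ] fun ω => gaussMoment (μ.map X) 1 t (X ω + G ω)
        / gaussMoment (μ.map X) 0 t (X ω + G ω) := by
  have hP : IsProbabilityMeasure (μ.map X) := Measure.isProbabilityMeasure_map hX.aemeasurable
  have hm0 := measurable_gaussMoment (μ.map X) ht 0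
  have hm1 := measurable_gaussMoment (μ.map X) ht 1
  have hpos := gaussMoment_zero_pos (μ.map X) ht
  set w : ℝ → ℝ := fun y => gaussMoment (μ.map X) 1 t y / gaussMoment (μ.map X) 0 t y with hw
  have hwm : Measurable w := hm1.div hm0
  have hY : Measurable (fun ω => X ω + G ω) := hX.add hGm
  have hGi : Integrable G μ := (memLp_gaussian hG).integrable one_le_two
  have hmul : ∀ y, gaussMoment (μ.map X) 0 t y * w y = gaussMoment (μ.map X) 1 t y :=
    fun y => mul_div_cancel₀ _ (hpos y).ne'
  have hwi : Integrable (fun ω => w (X ω + G ω)) μ := by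
    rw [integrable_comp_add_iff ht hX hG hXG hwm]
    simp only [hmul]
    exact integrable_gaussMoment _ ht 1
  -- On an event `Y ∈ B`, both `G` and the candidate integrate to the integral of `m_1` over `B`.
  refine (ae_eq_condExp_of_forall_setIntegral_eq hY.comap_le hGi
    (fun s _ _ => hwi.integrableOn) ?_ ?_).symm
  · rintro s ⟨B, hB, rfl⟩ -
    have hpre := hY hB
    rw [← integral_indicator hpre, ← integral_indicator hpre]
    have e1 : ((fun ω => X ω + G ω) ⁻¹' B).indicator (fun ω => w (X ω + G ω))
        = fun ω => B.indicator w (X ω + G ω) := by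
      rfl
    have e2 : ((fun ω => X ω + G ω) ⁻¹' B).indicator G
        = fun ω => (fun p : ℝ × ℝ => B.indicator (fun _ => 1) p.2 * (p.2 - p.1))
          (X ω, X ω + G ω) := by
      ext ω
      by_cases h : X ω + G ω ∈ B
      · rw [indicator_of_mem (by exact h)]; simp [h]
      · rw [indicator_of_notMem (by exact h)]; simp [h]
    have hFm : Measurable fun p : ℝ × ℝ => B.indicator (fun _ => (1 : ℝ)) p.2 * (p.2 - p.1) :=
      ((measurable_const.indicator hB).comp measurable_snd).mul (by fun_prop)
    have hFi := hGi.indicator hpre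
    rw [e2] at hFi
    rw [e1, e2, integral_comp_add ht hX hG hXG (hwm.indicator hB),
      integral_prodMk_add ht hX hG hXG hFm hFi]
    refine integral_congr_ae (.of_forall fun y => ?_)
    simp only
    by_cases hy : y ∈ B
    · simp only [indicator_of_mem hy, one_mul]
      rw [hmul]
      simp only [gaussMoment, pow_one]
    · simp [indicator_of_notMem hy]
  · exact (hwm.comp (comap_measurable _)).aestronglyMeasurable

/-- The minimum mean square error for the input given the output. -/
lemma integral_sub_condExp_sq (ht : 0 < t) (hX : Measurable X) (hX2 : MemLp X 2 μ)
    (hGm : Measurable G) (hG : HasLaw G (gaussianReal 0 t.toNNReal) μ) (hXG : IndepFun X G μ) :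
    ∫ ω, (X ω - (μ[X | MeasurableSpace.comap (fun ω => X ω + G ω) inferInstance]) ω) ^ 2 ∂μ
      = t - noiseEnergy (μ.map X) t := by
  have hP : IsProbabilityMeasure (μ.map X) := Measure.isProbabilityMeasure_map hX.aemeasurable
  have hm0 := measurable_gaussMoment (μ.map X) ht 0
  have hm1 := measurable_gaussMoment (μ.map X) ht 1
  have hpos := gaussMoment_zero_pos (μ.map X) ht
  have hY : Measurable (fun ω => X ω + G ω) := hX.add hGm
  have hle := hY.comap_le
  have hXi : Integrable X μ := hX2.integrable one_le_two
  have hG2 := memLp_gaussian hG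
  have hGi : Integrable G μ := hG2.integrable one_le_two
  have hcond := condExp_noise ht hX hGm hG hXG
  have hYc : μ[X + G | MeasurableSpace.comap (fun ω => X ω + G ω) inferInstance] = X + G :=
    condExp_of_stronglyMeasurable hle (comap_measurable _).stronglyMeasurable (hXi.add hGi)
  have hadd := condExp_add hXi hGi (MeasurableSpace.comap (fun ω => X ω + G ω) inferInstance)
  rw [hYc] at hadd
  -- Since `X + G` is known from the output, the errors in estimating `X` and `G` are opposite.
  have h1 : ∫ ω, (X ω - (μ[X | MeasurableSpace.comap (fun ω => X ω + G ω) inferInstance]) ω) ^ 2 ∂μ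
      = ∫ ω, (G ω - (μ[G | MeasurableSpace.comap (fun ω => X ω + G ω) inferInstance]) ω) ^ 2
        ∂μ := by
    refine integral_congr_ae ?_
    filter_upwards [hadd] with ω hω
    simp only [Pi.add_apply] at hω
    rw [← neg_sq]
    congr 1
    linarith
  have h5 : (fun ω => (μ[G | MeasurableSpace.comap (fun ω => X ω + G ω) inferInstance]) ω ^ 2)
      =ᵐ[μ] fun ω => (fun y => (gaussMoment (μ.map X) 1 t y
        / gaussMoment (μ.map X) 0 t y) ^ 2) (X ω + G ω) := by
    filter_upwards [hcond] with ω hω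
    rw [hω]
  have h4 : ∫ y, gaussMoment (μ.map X) 0 t y * (gaussMoment (μ.map X) 1 t y
      / gaussMoment (μ.map X) 0 t y) ^ 2 = noiseEnergy (μ.map X) t := by
    refine integral_congr_ae (.of_forall fun y => ?_)
    have := (hpos y).ne'
    simp only
    field_simp
  rw [h1, integral_sub_condExp_sq_eq hle hG2, integral_congr_ae h5,
    integral_comp_add (g := fun y => (gaussMoment (μ.map X) 1 t y
      / gaussMoment (μ.map X) 0 t y) ^ 2) ht hX hG hXG ((hm1.div hm0).pow_const 2), h4, variance_gaussian ht.le hG,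
    integral_gaussian hG]
  ring

end AdditiveNoise

end

/-! ### Convexity criterion, smoothness and rescaling -/

section

/-- Second-order characterization of convexity on a nontrivial interval, endpoints included. -/
lemma convexOn_iff_of_hasDerivAt {D : Set ℝ} (hD : Convex ℝ D) (hDn : D.Nontrivial)
    {f f' f'' : ℝ → ℝ} (hf : ∀ x ∈ D, HasDerivAt f (f' x) x)
    (hf' : ∀ x ∈ D, HasDerivAt f' (f'' x) x) :
    ConvexOn ℝ D f ↔ ∀ x ∈ D, 0 ≤ f'' x := by
  constructor
  · intro hc x hx
    have hmono : MonotoneOn f' D := by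
      intro a ha b hb hab
      rcases hab.eq_or_lt with rfl | hlt
      · exact le_rfl
      · exact (hc.le_slope_of_hasDerivAt ha hb hlt (hf a ha)).trans
          (hc.slope_le_of_hasDerivAt ha hb hlt (hf b hb))
    -- Endpoints are covered as well: every point of a nontrivial interval is an accumulation point
    -- of it, so the derivative of `f'` within `D` inherits the sign.
    exact (hf' x hx).hasDerivWithinAt.nonneg_of_monotoneOn
      (hD.isPreconnected.preperfect_of_nontrivial hDn x hx) hmono
  · intro h
    exact convexOn_of_hasDerivWithinAt2_nonneg hD
      (fun x hx => (hf x hx).continuousAt.continuousWithinAt)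
      (fun x hx => (hf x (interior_subset hx)).hasDerivWithinAt)
      (fun x hx => (hf' x (interior_subset hx)).hasDerivWithinAt)
      (fun x hx => h x (interior_subset hx))

lemma contDiff_gaussMoment (ν : Measure ℝ) [IsFiniteMeasure ν] {t : ℝ} (ht : 0 < t) (n k : ℕ) :
    ContDiff ℝ n (gaussMoment ν k t) := by
  induction n generalizing k with
  | zero => exact contDiff_zero.2 (continuous_gaussMoment ν ht k)
  | succ n ih =>
    have hd := hasDerivAt_gaussMoment_space ν ht k
    have hderiv : deriv (gaussMoment ν k t)
        = fun y => k * gaussMoment ν (k - 1) t y - gaussMoment ν (k + 1) t y / t :=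
      funext fun y => (hd y).deriv
    push_cast
    refine contDiff_succ_iff_deriv.2 ⟨fun y => (hd y).differentiableAt, by simp, ?_⟩
    rw [hderiv]
    exact (contDiff_const.mul (ih _)).sub ((ih _).div_const t)

lemma heatKernel_one_eq {t : ℝ} (ht : 0 < t) (z : ℝ) :
    heatKernel 1 z = √t * heatKernel t (√t * z) := by
  unfold heatKernel
  rw [mul_pow, Real.sq_sqrt ht.le, mul_one, Real.sqrt_mul (by positivity) t]
  have h1 : -(t * z ^ 2) / (2 * t) = -z ^ 2 / (2 * 1) := by field_simp
  have h2 : √t ≠ 0 := (Real.sqrt_pos.2 ht).ne'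
  rw [h1]
  field_simp

lemma sqrt_mul_sqrt_mul_input {P ρ : ℝ} (hP : 0 < P) (hρ : 0 < ρ) (x : ℝ) :
    √(P / ρ) * (√ρ * (x / √P)) = x := by
  have h1 : √ρ ≠ 0 := (Real.sqrt_pos.2 hρ).ne'
  have h2 : √P ≠ 0 := (Real.sqrt_pos.2 hP).ne'
  rw [Real.sqrt_div' _ hρ.le]
  field_simp

/-- The bridge between the two channels: after rescaling, the normalized output at `ρ` is the input
plus noise of variance `P / ρ`. -/
lemma sqrt_mul_channelOutput {Ω : Type*} {X S W : Ω → ℝ} {P ρ : ℝ} (hP : 0 < P) (hS : ∀ ω, S ω = X ω / √P) (hρ : 0 < ρ) (ω : Ω) :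
    √(P / ρ) * channelOutput S W ρ ω = X ω + √(P / ρ) * W ω := by
  rw [channelOutput, mul_add, hS, sqrt_mul_sqrt_mul_input hP hρ]

/-! ### The three conditions in terms of the variance defect -/

section Channel

variable {Ω : Type*} [MeasurableSpace Ω] {μ : Measure Ω} {X S W : Ω → ℝ} {P ρ : ℝ}

lemma outputDensity_eq (hX : Measurable X) (hP : 0 < P) (hS : ∀ ω, S ω = X ω / √P) (hρ : 0 < ρ)
    (y : ℝ) : outputDensity μ S ρ y
      = √(P / ρ) * gaussMoment (μ.map X) 0 (P / ρ) (√(P / ρ) * y) := by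
  have ht : 0 < P / ρ := by positivity
  rw [gaussMoment, integral_map hX.aemeasurable (by fun_prop), ← integral_const_mul, outputDensity]
  refine integral_congr_ae (.of_forall fun ω => ?_)
  simp only
  rw [gaussianPDFReal_eq_heatKernel, NNReal.coe_one, heatKernel_one_eq ht, sub_zero, mul_sub, hS,
    sqrt_mul_sqrt_mul_input hP hρ, pow_zero, one_mul]

lemma hasLaw_sqrt_mul (hWlaw : HasLaw W (gaussianReal 0 1) μ) {t : ℝ} (ht : 0 ≤ t) :
    HasLaw (fun ω => √t * W ω) (gaussianReal 0 t.toNNReal) μ := by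
  have h := gaussianReal_const_mul hWlaw (√t)
  rw [mul_zero, mul_one] at h
  convert h using 2
  ext
  simp [Real.sq_sqrt ht, ht]

lemma indepFun_sqrt_mul (hP : 0 < P) (hS : ∀ ω, S ω = X ω / √P) (hSW : IndepFun S W μ) (c : ℝ) :
    IndepFun X (fun ω => c * W ω) μ := by
  have h := hSW.comp (φ := fun s => √P * s) (ψ := fun w => c * w) (by fun_prop) (by fun_prop)
  have e : (fun s => √P * s) ∘ S = X := by
    ext ω
    have : √P ≠ 0 := (Real.sqrt_pos.2 hP).ne'
    simp only [Function.comp, hS]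
    field_simp
  rwa [e] at h

variable [IsProbabilityMeasure μ]

/-- Tweedie's formula: the score is minus the conditional mean of the noise, in rescaled units. -/
lemma score_eq (hX : Measurable X) (hP : 0 < P) (hS : ∀ ω, S ω = X ω / √P) (hρ : 0 < ρ) :
    score μ S ρ = fun y => -(gaussMoment (μ.map X) 1 (P / ρ) (√(P / ρ) * y)
      / gaussMoment (μ.map X) 0 (P / ρ) (√(P / ρ) * y)) / √(P / ρ) := by
  have hPr : IsProbabilityMeasure (μ.map X) := Measure.isProbabilityMeasure_map hX.aemeasurable
  have ht : 0 < P / ρ := by positivity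
  have hs : 0 < √(P / ρ) := Real.sqrt_pos.2 ht
  have hss : √(P / ρ) * √(P / ρ) = P / ρ := Real.mul_self_sqrt ht.le
  ext y
  have hpos := gaussMoment_zero_pos (μ.map X) ht (√(P / ρ) * y)
  have hfun : (fun y => Real.log (outputDensity μ S ρ y))
      = fun y => Real.log (√(P / ρ) * gaussMoment (μ.map X) 0 (P / ρ) (√(P / ρ) * y)) :=
    funext fun y => by rw [outputDensity_eq hX hP hS hρ]
  have h := ((((hasDerivAt_gaussMoment_space (μ.map X) ht 0 (√(P / ρ) * y)).comp y
    ((hasDerivAt_id y).const_mul (√(P / ρ)))).const_mul (√(P / ρ))).log (by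
      simp only [Function.comp]; positivity)).deriv
  rw [score, hfun]
  refine h.trans ?_
  simp only [Function.comp]
  set s := √(P / ρ)
  rw [← hss]
  norm_num
  field_simp

/-- The second-order Tweedie formula: one more derivative turns the conditional mean into `Var(G |
Y) / t - 1` with `t = P / ρ`. -/
lemma logDensityDeriv2_eq (hX : Measurable X) (hP : 0 < P) (hS : ∀ ω, S ω = X ω / √P)
    (hρ : 0 < ρ) :
    logDensityDeriv2 μ S ρ = fun y => (gaussMoment (μ.map X) 2 (P / ρ) (√(P / ρ) * y)
        / gaussMoment (μ.map X) 0 (P / ρ) (√(P / ρ) * y)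
      - (gaussMoment (μ.map X) 1 (P / ρ) (√(P / ρ) * y)
        / gaussMoment (μ.map X) 0 (P / ρ) (√(P / ρ) * y)) ^ 2) / (P / ρ) - 1 := by
  have hPr : IsProbabilityMeasure (μ.map X) := Measure.isProbabilityMeasure_map hX.aemeasurable
  have ht : 0 < P / ρ := by positivity
  have hs : 0 < √(P / ρ) := Real.sqrt_pos.2 ht
  have hss : √(P / ρ) * √(P / ρ) = P / ρ := Real.mul_self_sqrt ht.le
  ext y
  have hpos := gaussMoment_zero_pos (μ.map X) ht (√(P / ρ) * y)
  have h0 := (hasDerivAt_gaussMoment_space (μ.map X) ht 0 (√(P / ρ) * y)).comp y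
    ((hasDerivAt_id y).const_mul (√(P / ρ)))
  have h1 := (hasDerivAt_gaussMoment_space (μ.map X) ht 1 (√(P / ρ) * y)).comp y
    ((hasDerivAt_id y).const_mul (√(P / ρ)))
  have h := ((h1.div h0 hpos.ne').neg.div_const (√(P / ρ))).deriv
  have hsc : logDensityDeriv2 μ S ρ = deriv (score μ S ρ) := by
    rw [logDensityDeriv2, iteratedDeriv_succ, iteratedDeriv_one, score]
  rw [hsc, score_eq hX hP hS hρ]
  refine h.trans ?_
  simp only [Function.comp]
  norm_num
  generalize gaussMoment (μ.map X) 0 (P / ρ) (√(P / ρ) * y) = m₀ at hpos ⊢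
  generalize gaussMoment (μ.map X) 1 (P / ρ) (√(P / ρ) * y) = m₁
  generalize gaussMoment (μ.map X) 2 (P / ρ) (√(P / ρ) * y) = m₂
  generalize √(P / ρ) = s at hs hss
  rw [← hss]
  field_simp
  ring

lemma fisherInfo_eq (hX : Measurable X) (hP : 0 < P) (hS : ∀ ω, S ω = X ω / √P)
    (hWlaw : HasLaw W (gaussianReal 0 1) μ) (hSW : IndepFun S W μ) (hρ : 0 < ρ) :
    Integrable (fun ω => score μ S ρ (channelOutput S W ρ ω) ^ 2) μ ∧
      fisherInfo μ S W ρ = noiseEnergy (μ.map X) (P / ρ) / (P / ρ) := by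
  have hPr : IsProbabilityMeasure (μ.map X) := Measure.isProbabilityMeasure_map hX.aemeasurable
  have ht : 0 < P / ρ := by positivity
  have hG := hasLaw_sqrt_mul hWlaw ht.le
  have hXG := indepFun_sqrt_mul hP hS hSW (√(P / ρ))
  set g : ℝ → ℝ := fun y => (gaussMoment (μ.map X) 1 (P / ρ) y
    / gaussMoment (μ.map X) 0 (P / ρ) y) ^ 2 / (P / ρ) with hg
  have hgm : Measurable g := ((measurable_gaussMoment _ ht 1).div
    (measurable_gaussMoment _ ht 0)).pow_const 2 |>.div_const _
  have hfun : (fun ω => score μ S ρ (channelOutput S W ρ ω) ^ 2)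
      = fun ω => g (X ω + √(P / ρ) * W ω) := by
    ext ω
    rw [score_eq hX hP hS hρ]
    simp only [sqrt_mul_channelOutput hP hS hρ, hg]
    rw [div_pow, neg_sq, Real.sq_sqrt ht.le]
  have hint : (fun y => gaussMoment (μ.map X) 0 (P / ρ) y * g y)
      = fun y => gaussMoment (μ.map X) 1 (P / ρ) y ^ 2
        / gaussMoment (μ.map X) 0 (P / ρ) y / (P / ρ) := by
    ext y
    have := gaussMoment_zero_pos (μ.map X) ht y
    simp only [hg]
    field_simp
  constructor
  · rw [hfun, integrable_comp_add_iff ht hX hG hXG hgm, hint]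
    exact (integrable_noiseEnergy_integrand _ ht).div_const _
  · rw [fisherInfo, hfun, integral_comp_add ht hX hG hXG hgm, hint, integral_div]
    rfl

lemma integral_logDensityDeriv2_sq (hX : Measurable X) (hP : 0 < P) (hS : ∀ ω, S ω = X ω / √P)
    (hWlaw : HasLaw W (gaussianReal 0 1) μ) (hSW : IndepFun S W μ) (hρ : 0 < ρ) :
    Integrable (fun ω => logDensityDeriv2 μ S ρ (channelOutput S W ρ ω) ^ 2) μ ∧
      ∫ ω, logDensityDeriv2 μ S ρ (channelOutput S W ρ ω) ^ 2 ∂μ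
        = varianceDefect (μ.map X) (P / ρ) := by
  have hPr : IsProbabilityMeasure (μ.map X) := Measure.isProbabilityMeasure_map hX.aemeasurable
  have ht : 0 < P / ρ := by positivity
  have hG := hasLaw_sqrt_mul hWlaw ht.le
  have hXG := indepFun_sqrt_mul hP hS hSW (√(P / ρ))
  set g : ℝ → ℝ := fun y => ((gaussMoment (μ.map X) 2 (P / ρ) y / gaussMoment (μ.map X) 0 (P / ρ) y
    - (gaussMoment (μ.map X) 1 (P / ρ) y / gaussMoment (μ.map X) 0 (P / ρ) y) ^ 2) / (P / ρ) - 1) ^ 2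
    with hg
  have hm := fun k => measurable_gaussMoment (μ.map X) ht k
  have hgm : Measurable g := ((((hm 2).div (hm 0)).sub
    (((hm 1).div (hm 0)).pow_const 2)).div_const _ |>.sub_const 1).pow_const 2
  have hfun : (fun ω => logDensityDeriv2 μ S ρ (channelOutput S W ρ ω) ^ 2)
      = fun ω => g (X ω + √(P / ρ) * W ω) := by
    ext ω
    rw [logDensityDeriv2_eq hX hP hS hρ]
    simp only [sqrt_mul_channelOutput hP hS hρ, hg]
  constructor
  · rw [hfun, integrable_comp_add_iff ht hX hG hXG hgm]
    exact integrable_varianceDefect_integrand _ ht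
  · rw [hfun, integral_comp_add ht hX hG hXG hgm]
    rfl

lemma mmse_eq (hX : Measurable X) (hX2 : MemLp X 2 μ) (hP : 0 < P) (hS : ∀ ω, S ω = X ω / √P)
    (hW : Measurable W) (hWlaw : HasLaw W (gaussianReal 0 1) μ) (hSW : IndepFun S W μ)
    (hρ : 0 < ρ) :
    mmse μ S W ρ = (P / ρ - noiseEnergy (μ.map X) (P / ρ)) / P := by
  have ht : 0 < P / ρ := by positivity
  have hs : √(P / ρ) ≠ 0 := (Real.sqrt_pos.2 ht).ne'
  have hG := hasLaw_sqrt_mul hWlaw ht.le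
  have hXG := indepFun_sqrt_mul hP hS hSW (√(P / ρ))
  -- The two outputs differ by a nonzero factor, hence generate the same σ-algebra.
  have hcomap : MeasurableSpace.comap (channelOutput S W ρ) (inferInstance : MeasurableSpace ℝ)
      = MeasurableSpace.comap (fun ω => X ω + √(P / ρ) * W ω) inferInstance := by
    have e : (fun ω => X ω + √(P / ρ) * W ω)
        = (fun y => √(P / ρ) * y) ∘ channelOutput S W ρ :=
      funext fun ω => (sqrt_mul_channelOutput hP hS hρ ω).symm
    rw [e, ← MeasurableSpace.comap_comp]
    congr 1
    exact ((Homeomorph.mulLeft₀ _ hs).measurableEmbedding.comap_eq).symm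
  have hSX : S = (√P)⁻¹ • X := by
    ext ω; rw [hS, Pi.smul_apply, smul_eq_mul, div_eq_inv_mul]
  have hcond := condExp_smul (μ := μ) (√P)⁻¹ X
    (MeasurableSpace.comap (fun ω => X ω + √(P / ρ) * W ω) inferInstance)
  rw [← hSX] at hcond
  rw [← integral_sub_condExp_sq ht hX hX2 (hW.const_mul _) hG hXG, ← integral_div, mmse, hcomap]
  refine integral_congr_ae ?_
  filter_upwards [hcond] with ω hω
  rw [hω, hS, Pi.smul_apply, smul_eq_mul, ← div_eq_inv_mul, ← sub_div, div_pow, Real.sq_sqrt hP.le]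

lemma hasDerivAt_const_div {ρ : ℝ} (P : ℝ) (hρ : ρ ≠ 0) :
    HasDerivAt (fun r => P / r) (-P / ρ ^ 2) ρ := by
  refine ((hasDerivAt_inv hρ).const_mul P).congr_deriv ?_
  field_simp

/-- With `t = P/ρ` and `J = L/t`, the formula for `L'` gives `ρ dJ/dρ = V - L/t`; adding `J` leaves
`V`. -/
lemma hasDerivAt_mul_fisherInfo (hX : Measurable X) (hP : 0 < P) (hS : ∀ ω, S ω = X ω / √P)
    (hWlaw : HasLaw W (gaussianReal 0 1) μ) (hSW : IndepFun S W μ) (hρ : 0 < ρ) :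
    HasDerivAt (fun r => r * fisherInfo μ S W r) (varianceDefect (μ.map X) (P / ρ)) ρ := by
  have hPr : IsProbabilityMeasure (μ.map X) := Measure.isProbabilityMeasure_map hX.aemeasurable
  have ht : 0 < P / ρ := by positivity
  have hd := hasDerivAt_const_div P hρ.ne'
  have hL := HasDerivAt.comp ρ (hasDerivAt_noiseEnergy (μ.map X) ht) hd
  have h := (hasDerivAt_id ρ).mul (hL.div hd ht.ne')
  refine (h.congr_deriv ?_).congr_of_eventuallyEq ?_
  · simp only [Function.comp, id, Pi.div_apply]
    field_simp
    ring
  · filter_upwards [lt_mem_nhds hρ] with r hr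
    simp only [Pi.mul_apply, id, Pi.div_apply, Function.comp]
    rw [(fisherInfo_eq hX hP hS hWlaw hSW hr).2]

lemma hasDerivAt_mul_mmse (hX : Measurable X) (hX2 : MemLp X 2 μ) (hP : 0 < P)
    (hS : ∀ ω, S ω = X ω / √P) (hW : Measurable W) (hWlaw : HasLaw W (gaussianReal 0 1) μ)
    (hSW : IndepFun S W μ) (hρ : 0 < ρ) :
    HasDerivAt (fun r => r * mmse μ S W r)
      ((noiseEnergy (μ.map X) (P / ρ) - P / ρ * varianceDefect (μ.map X) (P / ρ)) / P) ρ := by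
  have hPr : IsProbabilityMeasure (μ.map X) := Measure.isProbabilityMeasure_map hX.aemeasurable
  have ht : 0 < P / ρ := by positivity
  have hd := hasDerivAt_const_div P hρ.ne'
  have hL := HasDerivAt.comp ρ (hasDerivAt_noiseEnergy (μ.map X) ht) hd
  have h := (hasDerivAt_id ρ).mul ((hd.sub hL).div_const P)
  refine (h.congr_deriv ?_).congr_of_eventuallyEq ?_
  · simp only [Function.comp, id, Pi.sub_apply]
    field_simp
    ring
  · filter_upwards [lt_mem_nhds hρ] with r hr
    simp only [Pi.mul_apply, id, Pi.sub_apply, Function.comp]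
    rw [mmse_eq hX hX2 hP hS hW hWlaw hSW hr]

lemma C1_iff (hX : Measurable X) (hX2 : MemLp X 2 μ) (hP : 0 < P)
    (hS : ∀ ω, S ω = X ω / √P) (hW : Measurable W) (hWlaw : HasLaw W (gaussianReal 0 1) μ)
    (hSW : IndepFun S W μ) (hρ : 0 < ρ) :
    C1 μ S W ρ ↔ varianceDefect (μ.map X) (P / ρ) ≤ 1 := by
  -- The extra summand `mmse` in the condition is exactly what cancels the noise energy.
  have e : (P / ρ - noiseEnergy (μ.map X) (P / ρ)) / P
      + (noiseEnergy (μ.map X) (P / ρ) - P / ρ * varianceDefect (μ.map X) (P / ρ)) / P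
      = ρ⁻¹ * (1 - varianceDefect (μ.map X) (P / ρ)) := by
    field_simp
    ring
  rw [C1, (hasDerivAt_mul_mmse hX hX2 hP hS hW hWlaw hSW hρ).deriv,
    mmse_eq hX hX2 hP hS hW hWlaw hSW hρ, e, mul_nonneg_iff_of_pos_left (by positivity),
    sub_nonneg]

lemma C2_iff (hX : Measurable X) (hP : 0 < P) (hS : ∀ ω, S ω = X ω / √P)
    (hWlaw : HasLaw W (gaussianReal 0 1) μ) (hSW : IndepFun S W μ) (hρ : 0 < ρ) :
    C2 μ S W ρ ↔ varianceDefect (μ.map X) (P / ρ) ≤ 1 := by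
  rw [C2, (hasDerivAt_mul_fisherInfo hX hP hS hWlaw hSW hρ).deriv]

lemma C3_iff (hX : Measurable X) (hP : 0 < P) (hS : ∀ ω, S ω = X ω / √P)
    (hWlaw : HasLaw W (gaussianReal 0 1) μ) (hSW : IndepFun S W μ) (hρ : 0 < ρ) :
    C3 μ S W ρ ↔ varianceDefect (μ.map X) (P / ρ) ≤ 1 := by
  rw [C3, (integral_logDensityDeriv2_sq hX hP hS hWlaw hSW hρ).2]

end Channel

/-- The total noise of independent Gaussian noises is Gaussian and independent of the input. -/
lemma hasLaw_add_noise {Ω : Type*} [MeasurableSpace Ω] {μ : Measure Ω} {X A B : Ω → ℝ}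
    {a b : ℝ} (ha : 0 ≤ a) (hb : 0 ≤ b) (hX : Measurable X)
    (hA : HasLaw A (gaussianReal 0 a.toNNReal) μ) (hB : HasLaw B (gaussianReal 0 b.toNNReal) μ)
    (h : iIndepFun ![X, A, B] μ) :
    HasLaw (fun ω => A ω + B ω) (gaussianReal 0 (b + a).toNNReal) μ ∧
      IndepFun X (fun ω => A ω + B ω) μ := by
  have hmeas : ∀ i, AEMeasurable (![X, A, B] i) μ := by
    intro i
    fin_cases i
    · exact hX.aemeasurable
    · exact hA.aemeasurable
    · exact hB.aemeasurable
  have hAB : IndepFun A B μ := h.indepFun (i := 1) (j := 2) (by decide)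
  refine ⟨⟨hA.aemeasurable.add hB.aemeasurable, ?_⟩, ?_⟩
  · have := gaussianReal_add_gaussianReal_of_indepFun hAB hA.map_eq hB.map_eq
    rw [add_zero, ← Real.toNNReal_add ha hb, add_comm a b] at this
    exact this
  · exact ((h.indepFun_prodMk₀ hmeas 1 2 0 (by decide) (by decide)).comp
      (φ := fun p : ℝ × ℝ => p.1 + p.2) (ψ := id) (by fun_prop) measurable_id).symm

/-- Convexity in the noise power of the mutual information of the Gaussian channel. -/
lemma convexOn_mutualInfo_iff (ν : Measure ℝ) [IsProbabilityMeasure ν] (hν : MemLp id 2 ν) {Z : ℝ}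
    (hZ : 0 < Z) {D : Set ℝ} (hD : Convex ℝ D) (hDn : D.Nontrivial) (hD0 : D ⊆ Ici 0) :
    ConvexOn ℝ D (fun N =>
      -(Real.log (2 * Real.pi * (N + Z)) / 2) - 1 / 2 - negEntropy ν (N + Z)) ↔
    ∀ N ∈ D, varianceDefect ν (N + Z) ≤ 1 := by
  have hpos : ∀ N ∈ D, 0 < N + Z := fun N hN => add_pos_of_nonneg_of_pos (hD0 hN) hZ
  have hshift : ∀ N : ℝ, HasDerivAt (fun N => N + Z) 1 N := fun N => (hasDerivAt_id N).add_const Z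
  -- The first derivative is de Bruijn's identity plus that of the logarithm; in the second, the
  -- term `2L/t` of `L'` cancels the derivative of `1/t²`.
  rw [convexOn_iff_of_hasDerivAt hD hDn
    (f' := fun N => (noiseEnergy ν (N + Z) / (N + Z) ^ 2 - 1 / (N + Z)) / 2)
    (f'' := fun N => (1 - varianceDefect ν (N + Z)) / (2 * (N + Z) ^ 2))]
  · refine forall₂_congr fun N hN => ?_
    have := hpos N hN
    rw [le_div_iff₀ (by positivity), zero_mul, sub_nonneg]
  · intro N hN
    have ht := hpos N hN
    have h1 := ((((hshift N).const_mul (2 * Real.pi)).log (by positivity)).div_const 2).neg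
    have h2 := HasDerivAt.comp N (hasDerivAt_negEntropy hν ht) (hshift N)
    refine ((h1.sub_const (1 / 2)).sub h2).congr_deriv ?_
    field_simp
    ring
  · intro N hN
    have ht := hpos N hN
    have h1 := HasDerivAt.comp N (hasDerivAt_noiseEnergy ν ht) (hshift N)
    have h2 := (hshift N).fun_pow 2
    have h3 := (hshift N).inv ht.ne'
    have h := ((h1.div h2 (by positivity)).sub h3).div_const 2
    refine (h.congr_deriv ?_).congr_of_eventuallyEq (.of_forall fun M => ?_)
    · simp only [Function.comp]
      field_simp
      ring
    · simp [Function.comp]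

end

end NoiseConvexity

/-! ### The main theorem -/

theorem mainTheorem3 {Ω : Type*} [MeasurableSpace Ω] (μ : Measure Ω) [IsProbabilityMeasure μ]
    -- the input `X`, of arbitrary distribution with power `P`
    (X : Ω → ℝ) (P : ℝ) (hX : Measurable X) (hX2 : MemLp X 2 μ) (hXP : ∫ ω, X ω ^ 2 ∂μ = P)
    (hP : 0 < P)
    -- the physical noise `Zn`, of power `Z`, and the artificial noise `Nn N`, of power `N`
    (Z : ℝ) (hZ : 0 < Z) (Zn : Ω → ℝ) (hZn : HasLaw Zn (gaussianReal 0 Z.toNNReal) μ)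
    (Nn : ℝ → Ω → ℝ) (hNn : ∀ N, 0 ≤ N → HasLaw (Nn N) (gaussianReal 0 N.toNNReal) μ)
    (hindep : ∀ N, 0 ≤ N → iIndepFun ![X, Zn, Nn N] μ)
    -- the normalized input `S` and the normalized noise `W`
    (S : Ω → ℝ) (hS : ∀ ω, S ω = X ω / √P)
    (W : Ω → ℝ) (hW : Measurable W) (hWlaw : HasLaw W (gaussianReal 0 1) μ)
    (hSW : IndepFun S W μ) :
    -- all the quantities are well defined
    (∀ N, 0 ≤ N → NoiseConvexity.mutualInfo μ X (fun ω => X ω + Zn ω + Nn N ω) ≠ ∞) ∧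
    (∀ ρ, 0 < ρ →
      (∀ y, 0 < NoiseConvexity.outputDensity μ S ρ y) ∧
      ContDiff ℝ 2 (NoiseConvexity.outputDensity μ S ρ) ∧
      Integrable (fun ω =>
        (NoiseConvexity.score μ S ρ (NoiseConvexity.channelOutput S W ρ ω)) ^ 2) μ ∧
      Integrable (fun ω =>
        (NoiseConvexity.logDensityDeriv2 μ S ρ (NoiseConvexity.channelOutput S W ρ ω)) ^ 2) μ ∧
      DifferentiableAt ℝ (fun r => r * NoiseConvexity.mmse μ S W r) ρ ∧
      DifferentiableAt ℝ (fun r => r * NoiseConvexity.fisherInfo μ S W r) ρ) ∧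
    -- the three conditions are equivalent at every signal-to-noise ratio
    (∀ ρ, 0 < ρ →
      (NoiseConvexity.C1 μ S W ρ ↔ NoiseConvexity.C2 μ S W ρ) ∧
      (NoiseConvexity.C2 μ S W ρ ↔ NoiseConvexity.C3 μ S W ρ)) ∧
    -- each of them characterizes convexity in `N`, on `[0, ∞)` and on each of its subintervals
    (∀ D : Set ℝ, Convex ℝ D → D.Nontrivial → D ⊆ Ici 0 →
      (ConvexOn ℝ D
          (fun N => (NoiseConvexity.mutualInfo μ X (fun ω => X ω + Zn ω + Nn N ω)).toReal) ↔
        ∀ N ∈ D, NoiseConvexity.C1 μ S W (P / (N + Z))) ∧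
      (ConvexOn ℝ D
          (fun N => (NoiseConvexity.mutualInfo μ X (fun ω => X ω + Zn ω + Nn N ω)).toReal) ↔
        ∀ N ∈ D, NoiseConvexity.C2 μ S W (P / (N + Z))) ∧
      (ConvexOn ℝ D
          (fun N => (NoiseConvexity.mutualInfo μ X (fun ω => X ω + Zn ω + Nn N ω)).toReal) ↔
        ∀ N ∈ D, NoiseConvexity.C3 μ S W (P / (N + Z)))) := by
  have hPr : IsProbabilityMeasure (μ.map X) := Measure.isProbabilityMeasure_map hX.aemeasurable
  have hν : MemLp id 2 (μ.map X) :=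
    (memLp_map_measure_iff aestronglyMeasurable_id hX.aemeasurable).2 hX2
  have hnoise := fun (N : ℝ) (hN : 0 ≤ N) =>
    NoiseConvexity.hasLaw_add_noise hZ.le hN hX hZn (hNn N hN) (hindep N hN)
  have hinfo := fun (N : ℝ) (hN : 0 ≤ N) =>
    NoiseConvexity.mutualInfo_add (by linarith : 0 < N + Z) hX hX2 (hnoise N hN).1 (hnoise N hN).2
  simp only [← add_assoc] at hinfo
  have hconv : ∀ D : Set ℝ, Convex ℝ D → D.Nontrivial → D ⊆ Ici 0 →
      (ConvexOn ℝ D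
        (fun N => (NoiseConvexity.mutualInfo μ X (fun ω => X ω + Zn ω + Nn N ω)).toReal) ↔
        ∀ N ∈ D, NoiseConvexity.varianceDefect (μ.map X) (N + Z) ≤ 1) := by
    intro D hD hDn hD0
    rw [← NoiseConvexity.convexOn_mutualInfo_iff (μ.map X) hν hZ hD hDn hD0]
    -- The closed form at `N` depends on the noise only through its law and its independence of `X`,
    -- so no relation between the artificial noises at different `N` is needed.
    have heq : EqOn (fun N => (NoiseConvexity.mutualInfo μ X
        (fun ω => X ω + Zn ω + Nn N ω)).toReal) (fun N => -(Real.log (2 * Real.pi * (N + Z)) / 2)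
          - 1 / 2 - NoiseConvexity.negEntropy (μ.map X) (N + Z)) D :=
      fun N hN => (hinfo N (hD0 hN)).2
    exact ⟨fun h => h.congr heq, fun h => h.congr heq.symm⟩
  refine ⟨fun N hN => (hinfo N hN).1, fun ρ hρ => ?_, fun ρ hρ => ?_, fun D hD hDn hD0 => ?_⟩
  · have ht : 0 < P / ρ := by positivity
    have hfun : NoiseConvexity.outputDensity μ S ρ = fun y => √(P / ρ)
        * NoiseConvexity.gaussMoment (μ.map X) 0 (P / ρ) (√(P / ρ) * y) :=
      funext (NoiseConvexity.outputDensity_eq hX hP hS hρ)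
    refine ⟨fun y => ?_, ?_, (NoiseConvexity.fisherInfo_eq hX hP hS hWlaw hSW hρ).1,
      (NoiseConvexity.integral_logDensityDeriv2_sq hX hP hS hWlaw hSW hρ).1,
      (NoiseConvexity.hasDerivAt_mul_mmse hX hX2 hP hS hW hWlaw hSW hρ).differentiableAt,
      (NoiseConvexity.hasDerivAt_mul_fisherInfo hX hP hS hWlaw hSW hρ).differentiableAt⟩
    · rw [hfun]
      exact mul_pos (Real.sqrt_pos.2 ht) (NoiseConvexity.gaussMoment_zero_pos _ ht _)
    · rw [hfun]
      exact contDiff_const.mul ((NoiseConvexity.contDiff_gaussMoment _ ht 2 0).comp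
        (contDiff_const.mul contDiff_id))
  · rw [NoiseConvexity.C1_iff hX hX2 hP hS hW hWlaw hSW hρ,
      NoiseConvexity.C2_iff hX hP hS hWlaw hSW hρ, NoiseConvexity.C3_iff hX hP hS hWlaw hSW hρ]
    exact ⟨Iff.rfl, Iff.rfl⟩
  · have hρ : ∀ N ∈ D, 0 < P / (N + Z) := fun N hN =>
      div_pos hP (add_pos_of_nonneg_of_pos (hD0 hN) hZ)
    have hdiv : ∀ N, P / (P / (N + Z)) = N + Z := fun N => div_div_cancel₀ hP.ne'
    refine ⟨(hconv D hD hDn hD0).trans (forall₂_congr fun N hN => ?_),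
      (hconv D hD hDn hD0).trans (forall₂_congr fun N hN => ?_),
      (hconv D hD hDn hD0).trans (forall₂_congr fun N hN => ?_)⟩
    · rw [NoiseConvexity.C1_iff hX hX2 hP hS hW hWlaw hSW (hρ N hN), hdiv]
    · rw [NoiseConvexity.C2_iff hX hP hS hWlaw hSW (hρ N hN), hdiv]
    · rw [NoiseConvexity.C3_iff hX hP hS hWlaw hSW (hρ N hN), hdiv]
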